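/- Let $\Bbbk$ be an algebraically closed field of characteristic $0$. Let $Q$ be a finite quiver, write $\Bbbk Q$ for its path algebra (paths composed from left to right), and let $I\subseteq \Bbbk Q$ be a two-sided ideal such that $\Bbbk Q/I$ is gentle, i.e.: every vertex of $Q$ is the source of at most two arrows and the target of at most two arrows; $I$ is generated by paths of length two; for every arrow $a$ there is at most one arrow $b$ such that $ab$ is a path with $ab\in I$, at most one arrow $b'$ such that $ab'$ is a path with $ab'\notin I$, at most one arrow $c$ such that $ca$ is a path with $ca\in I$, and at most one arrow $c'$ such that $c'a$ is a path with $c'a\notin I$; and $\Bbbk Q/I$ is finite dimensional. Let $A$ be a $\Bbbk$-algebra isomorphic to $\Bbbk Q/I$. Call a path $p$ of $Q$ (trivial paths included) a maximal path of $A$ if $p\notin I$ and $pa,\,ap\in I$ for every arrow $a$ (a product of paths that cannot be concatenated being $0$). Suppose that $A$ has exactly one maximal path $p$, let $n-1$ be its length and let $v_1,\dots,v_n$ be the vertices successively visited by $p$. Then there is exactly one permutation $\alpha\in\mathfrak S_n$ such that, for all $i$, $\alpha(i)=j$ whenever $j\neq i$ and $v_j=v_i$, and $\alpha(i)=i$ if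 there is no such $j$; moreover $\alpha^2=\mathrm{id}$. ($\alpha$ is called the quasi-diagram associated to $A$.) Let $\zeta=(1\,2\,\cdots\,n)\in\mathfrak S_n$, with permutations composed from right to left. Then the following are equivalent: 1. $\operatorname{gldim} A<\infty$, where $\operatorname{gldim} A$ is the supremum of the projective dimensions of all right $A$-modules; 2. every orbit of $\zeta\alpha$ on $\{1,\dots,n\}$ contains $1$ or a fixed point of $\alpha$; 3. every orbit of $\alpha\zeta$ on $\{1,\dots,n\}$ contains $n$ or a fixed point of $\alpha$. The quasi-diagram $\alpha$ is called regular if the equivalent conditions 2 and 3 hold. -/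

import Mathlib

universe u v w

section PathAlgebras

/-- All paths of a quiver (with arbitrary endpoints, the trivial paths included). -/
abbrev QPath (V : Type u) [Quiver.{v} V] : Type (max u v) :=
  Σ a : V, Σ b : V, Quiver.Path a b

/-- The underlying vector space of the path algebra `k Q`: the `k`-vector space with basis the
set of all paths of the quiver. -/
def PathAlgebra (k : Type w) [Field k] (V : Type u) [Quiver.{v} V] : Type (max u v w) :=
  QPath V →₀ k

namespace PathAlgebra

variable {k : Type w} [Field k] {V : Type u} [Quiver.{v} V]

noncomputable instance : AddCommGroup (PathAlgebra k V) :=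
  inferInstanceAs (AddCommGroup (QPath V →₀ k))

noncomputable instance : Module k (PathAlgebra k V) :=
  inferInstanceAs (Module k (QPath V →₀ k))

variable (k) in
/-- The basis element of the path algebra given by a path. -/
noncomputable def ofPath {a b : V} (p : Quiver.Path a b) : PathAlgebra k V :=
  Finsupp.single (⟨a, b, p⟩ : QPath V) (1 : k)

variable (k) in
/-- The basis element of the path algebra given by an arrow. -/
noncomputable def ofArrow {a b : V} (e : a ⟶ b) : PathAlgebra k V :=
  ofPath k e.toPath

open Classical in
variable (k) in
/-- The product of two paths: their concatenation (from left to right) if the first one ends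
where the second one starts, and zero otherwise. -/
noncomputable def mulPath : QPath V → QPath V → PathAlgebra k V
  | ⟨_, b, p⟩, ⟨c, _, q⟩ =>
    if h : b = c then ofPath k (p.comp (h ▸ q)) else 0

variable (k V) in
/-- The bilinear extension of the product of paths. -/
noncomputable def mulHom : PathAlgebra k V →ₗ[k] PathAlgebra k V →ₗ[k] PathAlgebra k V :=
  Finsupp.linearCombination k (M := PathAlgebra k V →ₗ[k] PathAlgebra k V)
    fun p : QPath V => (Finsupp.linearCombination k (M := PathAlgebra k V)
      (fun q : QPath V => mulPath k p q) : (QPath V →₀ k) →ₗ[k] PathAlgebra k V)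

noncomputable instance : Mul (PathAlgebra k V) := ⟨fun x y => mulHom k V x y⟩

/-- The unit of the path algebra of a quiver with finitely many vertices: the sum of the trivial
paths. -/
noncomputable instance [Fintype V] : One (PathAlgebra k V) :=
  ⟨∑ a : V, ofPath k (Quiver.Path.nil : Quiver.Path a a)⟩

theorem mul_eq (x y : PathAlgebra k V) : x * y = mulHom k V x y := rfl

theorem one_eq [Fintype V] :
    (1 : PathAlgebra k V) = ∑ a : V, ofPath k (Quiver.Path.nil : Quiver.Path a a) := rfl

theorem ofPath_mul {a b c d : V} (p : Quiver.Path a b) (q : Quiver.Path c d) :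
    ofPath k p * ofPath k q = mulPath k ⟨a, b, p⟩ ⟨c, d, q⟩ := by
  rw [mul_eq]
  unfold mulHom ofPath
  erw [Finsupp.linearCombination_single, one_smul, Finsupp.linearCombination_single, one_smul]

theorem ofPath_mul_comp {a b c : V} (p : Quiver.Path a b) (q : Quiver.Path b c) :
    ofPath k p * ofPath k q = ofPath k (p.comp q) := by
  simp [ofPath_mul, mulPath]

theorem ofPath_mul_of_ne {a b c d : V} (p : Quiver.Path a b) (q : Quiver.Path c d) (h : b ≠ c) :
    ofPath k p * ofPath k q = 0 := by
  simp [ofPath_mul, mulPath, h]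

/-- Every element of the path algebra is a linear combination of paths. -/
theorem induction_on {P : PathAlgebra k V → Prop} (x : PathAlgebra k V) (zero : P 0)
    (add : ∀ x y, P x → P y → P (x + y))
    (path : ∀ (r : k) (a b : V) (p : Quiver.Path a b), P (r • ofPath k p)) : P x := by
  refine Finsupp.induction_linear (motive := P) x zero add fun p r => ?_
  have h : (Finsupp.single p r : QPath V →₀ k) = r • Finsupp.single p (1 : k) := by simp
  rw [h]
  exact path r p.1 p.2.1 p.2.2

theorem aux_add_mul (x y z : PathAlgebra k V) : (x + y) * z = x * z + y * z := by
  simp [mul_eq]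

theorem aux_mul_add (x y z : PathAlgebra k V) : x * (y + z) = x * y + x * z := by
  simp [mul_eq]

theorem aux_zero_mul (x : PathAlgebra k V) : 0 * x = 0 := by
  simp [mul_eq]

theorem aux_mul_zero (x : PathAlgebra k V) : x * 0 = 0 := by
  simp [mul_eq]

theorem aux_smul_mul (r : k) (x y : PathAlgebra k V) : (r • x) * y = r • (x * y) := by
  simp [mul_eq]

theorem aux_mul_smul (r : k) (x y : PathAlgebra k V) : x * (r • y) = r • (x * y) := by
  simp [mul_eq]

theorem aux_mul_assoc_path {a b c d e f : V} (p : Quiver.Path a b) (q : Quiver.Path c d)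
    (s : Quiver.Path e f) :
    ofPath k p * ofPath k q * ofPath k s = ofPath k p * (ofPath k q * ofPath k s) := by
  by_cases h₁ : b = c
  · subst h₁
    by_cases h₂ : d = e
    · subst h₂
      simp only [ofPath_mul_comp, Quiver.Path.comp_assoc]
    · rw [ofPath_mul_comp, ofPath_mul_of_ne _ _ h₂, ofPath_mul_of_ne _ _ h₂, aux_mul_zero]
  · rw [ofPath_mul_of_ne _ _ h₁, aux_zero_mul]
    by_cases h₂ : d = e
    · subst h₂
      rw [ofPath_mul_comp, ofPath_mul_of_ne _ _ h₁]
    · rw [ofPath_mul_of_ne _ _ h₂, aux_mul_zero]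

theorem aux_mul_assoc (x y z : PathAlgebra k V) : x * y * z = x * (y * z) := by
  induction x using induction_on with
  | zero => simp only [aux_zero_mul]
  | add x₁ x₂ h₁ h₂ => simp only [aux_add_mul, h₁, h₂]
  | path r a b p =>
    simp only [aux_smul_mul]
    congr 1
    induction y using induction_on with
    | zero => simp only [aux_zero_mul, aux_mul_zero]
    | add y₁ y₂ h₁ h₂ => simp only [aux_add_mul, aux_mul_add, h₁, h₂]
    | path r' c d q =>
      simp only [aux_smul_mul, aux_mul_smul]
      congr 1
      induction z using induction_on with
      | zero => simp only [aux_mul_zero]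
      | add z₁ z₂ h₁ h₂ => simp only [aux_mul_add, h₁, h₂]
      | path r'' e f s => simp only [aux_mul_smul, aux_mul_assoc_path]

theorem aux_one_mul [Fintype V] (x : PathAlgebra k V) : 1 * x = x := by
  induction x using induction_on with
  | zero => simp only [aux_mul_zero]
  | add x₁ x₂ h₁ h₂ => simp only [aux_mul_add, h₁, h₂]
  | path r a b p =>
    rw [aux_mul_smul, one_eq]
    congr 1
    have h : ∀ s : Finset V, (∑ c ∈ s, ofPath k (Quiver.Path.nil : Quiver.Path c c)) *
        ofPath k p = ∑ c ∈ s, ofPath k (Quiver.Path.nil : Quiver.Path c c) * ofPath k p := by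
      intro s
      simp [mul_eq]
    rw [h, Finset.sum_eq_single a]
    · rw [ofPath_mul_comp, Quiver.Path.nil_comp]
    · intro c _ hc
      exact ofPath_mul_of_ne _ _ hc
    · simp

theorem aux_mul_one [Fintype V] (x : PathAlgebra k V) : x * 1 = x := by
  induction x using induction_on with
  | zero => simp only [aux_zero_mul]
  | add x₁ x₂ h₁ h₂ => simp only [aux_add_mul, h₁, h₂]
  | path r a b p =>
    rw [aux_smul_mul, one_eq]
    congr 1
    have h : ∀ s : Finset V, ofPath k p *
        (∑ c ∈ s, ofPath k (Quiver.Path.nil : Quiver.Path c c)) =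
        ∑ c ∈ s, ofPath k p * ofPath k (Quiver.Path.nil : Quiver.Path c c) := by
      intro s
      simp [mul_eq]
    rw [h, Finset.sum_eq_single b]
    · rw [ofPath_mul_comp, Quiver.Path.comp_nil]
    · intro c _ hc
      exact ofPath_mul_of_ne _ _ (Ne.symm hc)
    · simp

/-- The path algebra of a quiver with finitely many vertices is a ring. -/
noncomputable instance [Fintype V] : Ring (PathAlgebra k V) :=
  { (inferInstance : AddCommGroup (PathAlgebra k V)) with
    mul := (· * ·)
    one := 1
    left_distrib := aux_mul_add
    right_distrib := aux_add_mul
    zero_mul := aux_zero_mul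
    mul_zero := aux_mul_zero
    mul_assoc := aux_mul_assoc
    one_mul := aux_one_mul
    mul_one := aux_mul_one }

noncomputable instance [Fintype V] : Algebra k (PathAlgebra k V) :=
  Algebra.ofModule aux_smul_mul aux_mul_smul

end PathAlgebra

end PathAlgebras

section GentleAlgebras

variable {k : Type w} [Field k] {V : Type u} [Quiver.{v} V] [Fintype V]

/-- The quotient algebra `k Q / I`. -/
abbrev QuiverAlgebra (I : TwoSidedIdeal (PathAlgebra k V)) : Type (max u v w) :=
  I.ringCon.Quotient

/-- `k Q / I` is a locally gentle algebra: `Q` is a finite quiver with at most two arrows starting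
and at most two arrows ending at each vertex, `I` is generated by paths of length two, and for each
arrow `e` there is at most one arrow `f` such that `e f` is a path with `e f ∈ I`, at most one such
that `e f` is a path with `e f ∉ I`, and similarly on the other side. -/
structure IsLocallyGentle (I : TwoSidedIdeal (PathAlgebra k V)) : Prop where
  finite_arrows : ∀ a b : V, Finite (a ⟶ b)
  card_starting : ∀ a : V, Nat.card (Σ b : V, (a ⟶ b)) ≤ 2
  card_ending : ∀ a : V, Nat.card (Σ b : V, (b ⟶ a)) ≤ 2
  generated : ∃ S : Set (QPath V), (∀ p ∈ S, p.2.2.length = 2) ∧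
    I = TwoSidedIdeal.span ((fun p : QPath V => PathAlgebra.ofPath k p.2.2) '' S)
  right_mem : ∀ (a b : V) (e : a ⟶ b), {f : Σ c : V, (b ⟶ c) |
    PathAlgebra.ofArrow k e * PathAlgebra.ofArrow k f.2 ∈ I}.Subsingleton
  left_mem : ∀ (a b : V) (e : a ⟶ b), {f : Σ c : V, (c ⟶ a) |
    PathAlgebra.ofArrow k f.2 * PathAlgebra.ofArrow k e ∈ I}.Subsingleton
  right_not_mem : ∀ (a b : V) (e : a ⟶ b), {f : Σ c : V, (b ⟶ c) |
    PathAlgebra.ofArrow k e * PathAlgebra.ofArrow k f.2 ∉ I}.Subsingleton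
  left_not_mem : ∀ (a b : V) (e : a ⟶ b), {f : Σ c : V, (c ⟶ a) |
    PathAlgebra.ofArrow k f.2 * PathAlgebra.ofArrow k e ∉ I}.Subsingleton

/-- `k Q / I` is a gentle algebra: it is locally gentle and finite dimensional. -/
structure IsGentle (I : TwoSidedIdeal (PathAlgebra k V)) : Prop extends IsLocallyGentle I where
  finite_dimensional : Module.Finite k (QuiverAlgebra I)

/-- A path `p` of the quiver is a maximal path of `k Q / I` if `p` is nonzero in `k Q / I`, and
`p e = e p = 0` in `k Q / I` for every arrow `e`. -/
def IsMaximalPath (I : TwoSidedIdeal (PathAlgebra k V)) (p : QPath V) : Prop :=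
  PathAlgebra.ofPath k p.2.2 ∉ I ∧ ∀ (a b : V) (e : a ⟶ b),
    PathAlgebra.ofPath k p.2.2 * PathAlgebra.ofArrow k e ∈ I ∧
    PathAlgebra.ofArrow k e * PathAlgebra.ofPath k p.2.2 ∈ I

end GentleAlgebras

section QuasiDiagrams

variable {V : Type u} [Quiver.{v} V]

/-- The `i`-th vertex of a path of length `l`, where `i` ranges over `0, …, l`. -/
def pathVertex {a b : V} (p : Quiver.Path a b) (i : Fin (p.length + 1)) : V :=
  p.vertices.get (i.cast p.vertices_length.symm)

/-- The permutation `α` of the positions `0, …, l` along a path of length `l` is the one associated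
to the path: `α i = j` if `j ≠ i` is a position at which the path visits the same vertex as at
position `i`, and `α i = i` if there is no such position `j`. -/
def IsAssociatedPerm {a b : V} (p : Quiver.Path a b) (α : Equiv.Perm (Fin (p.length + 1))) :
    Prop :=
  ∀ i, (∀ j, j ≠ i → pathVertex p j = pathVertex p i → α i = j) ∧
    ((¬ ∃ j, j ≠ i ∧ pathVertex p j = pathVertex p i) → α i = i)

/-- The orbits of a permutation. -/
def permOrbits {n : ℕ} (σ : Equiv.Perm (Fin n)) : Set (Set (Fin n)) :=
  Set.range fun i => MulAction.orbit (Subgroup.zpowers σ) i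

end QuasiDiagrams

section GlobalDimension

/-- The (right) global dimension of a ring: the supremum of the projective dimensions of all right
modules over it. -/
noncomputable def globalDimension (A : Type u) [Ring A] : WithBot ℕ∞ :=
  ⨆ M : ModuleCat.{u} Aᵐᵒᵖ, CategoryTheory.projectiveDimension M

end GlobalDimension

-- Right modules over `A` are left modules over `Aᵐᵒᵖ`. For an arrow `a` with target `t`, left
-- multiplication by `a` maps the projective `e_t A` onto `aA`. Its kernel is `bA` when there is an
-- arrow `b` with `ab` a path in `I` (there is at most one such `b`), and zero otherwise
-- (`isArrowSystem`). Thus `bA` is the first syzygy of `aA`. If relations form a cycle of arrows,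
-- the syzygies never become projective, since that would give `b = b r b` for some `b` in the
-- nilpotent radical. If there is no such cycle, all the `aA` have bounded projective dimension. So
-- does their direct sum, the radical, and hence so do the semisimple quotient and every module.
-- Therefore the global dimension is finite iff the graph of relations on the arrows is acyclic
-- (`globalDimension_lt_top_iff`).
--
-- Every arrow lies on some maximal path, so the unique one `p` runs through all arrows. It does so
-- only once, because an arrow has at most one predecessor with nonzero product and the first arrow
-- of `p` has none (`IsMaximalWalk.injective`). Label each arrow by the position of its target along
-- `p`. Two composable arrows form a relation iff they are not consecutive in `p`, that is, iff `p`
-- visits their common vertex at two different positions, which `α` exchanges. The successor of an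
-- arrow under relations is then given by `ζα`, undefined exactly at fixed points of `α`; position
-- `1`, written `0` in `Fin`, labels no arrow. Relation cycles are thus the orbits of `ζα` avoiding
-- `1` and the fixed points (`IsMaximalWalk.acyclic_iff`). Conjugation by `α` turns condition 2 into
-- condition 3.

universe u'

/-! ### Projective dimension: direct sums, and reduction to a semisimple quotient. -/

section ProjectiveDimension

open CategoryTheory

variable {R : Type u} [Ring R]

/-- The projective dimension of the `R`-module `M` is less than `n`. -/
def ProjDimLT (R : Type u) [Ring R] (M : Type u) [AddCommGroup M] [Module R M] (n : ℕ) : Prop :=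
  HasProjectiveDimensionLT (ModuleCat.of R M) n

section

variable {M M₁ M₂ M₃ : Type u} [AddCommGroup M] [Module R M] [AddCommGroup M₁] [Module R M₁]
  [AddCommGroup M₂] [Module R M₂] [AddCommGroup M₃] [Module R M₃]

theorem ProjDimLT.of_linearEquiv {n : ℕ} (h : ProjDimLT R M₁ n) (e : M₁ ≃ₗ[R] M₂) :
    ProjDimLT R M₂ n := by
  have : HasProjectiveDimensionLT (ModuleCat.of R M₁) n := h
  exact hasProjectiveDimensionLT_of_iso e.toModuleIso n

theorem ProjDimLT.mono {m n : ℕ} (h : ProjDimLT R M m) (hmn : m ≤ n) : ProjDimLT R M n := by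
  have : HasProjectiveDimensionLT (ModuleCat.of R M) m := h
  exact hasProjectiveDimensionLT_of_ge _ m n hmn

theorem projDimLT_one_iff : ProjDimLT R M 1 ↔ Module.Projective R M := by
  unfold ProjDimLT
  rw [← projective_iff_hasProjectiveDimensionLT_one, ← IsProjective.iff_projective]

theorem projDimLT_of_projective [Module.Projective R M] (n : ℕ) : ProjDimLT R M (n + 1) :=
  (projDimLT_one_iff.2 ‹_›).mono (by omega)

theorem projDimLT_of_subsingleton [Subsingleton M] (n : ℕ) : ProjDimLT R M n :=
  ProjDimLT.mono (m := 0)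
    (ModuleCat.isZero_of_subsingleton (ModuleCat.of R M)).hasProjectiveDimensionLT_zero
    (Nat.zero_le n)

theorem ProjDimLT.of_retract {n : ℕ} (h : ProjDimLT R M₂ n) (i : M₁ →ₗ[R] M₂) (r : M₂ →ₗ[R] M₁)
    (hri : r ∘ₗ i = LinearMap.id) : ProjDimLT R M₁ n := by
  have : HasProjectiveDimensionLT (ModuleCat.of R M₂) n := h
  refine Retract.hasProjectiveDimensionLT (Y := ModuleCat.of R M₂)
    ⟨ModuleCat.ofHom i, ModuleCat.ofHom r, ?_⟩ n
  rw [← ModuleCat.ofHom_comp, hri]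
  rfl

variable {f : M₁ →ₗ[R] M₂} {g : M₂ →ₗ[R] M₃}

theorem shortExact_of_linearMap (hf : Function.Injective f) (hg : Function.Surjective g)
    (h : Function.Exact f g) :
    (ShortComplex.mk (ModuleCat.ofHom f) (ModuleCat.ofHom g)
      (by ext x; exact h.apply_apply_eq_zero x)).ShortExact where
  exact := (ShortComplex.ShortExact.moduleCat_exact_iff_function_exact _).2 h
  mono_f := (ModuleCat.mono_iff_injective _).2 hf
  epi_g := (ModuleCat.epi_iff_surjective _).2 hg

theorem ProjDimLT.middle (hf : Function.Injective f) (hg : Function.Surjective g)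
    (h : Function.Exact f g) {n : ℕ} (h₁ : ProjDimLT R M₁ n) (h₃ : ProjDimLT R M₃ n) :
    ProjDimLT R M₂ n :=
  (shortExact_of_linearMap hf hg h).hasProjectiveDimensionLT_X₂ n h₁ h₃

theorem projDimLT_right_iff (hf : Function.Injective f) (hg : Function.Surjective g)
    (h : Function.Exact f g) [Module.Projective R M₂] (n : ℕ) :
    ProjDimLT R M₃ (n + 2) ↔ ProjDimLT R M₁ (n + 1) :=
  (shortExact_of_linearMap hf hg h).hasProjectiveDimensionLT_X₃_iff n
    ((IsProjective.iff_projective _).1 ‹_›)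

end

theorem exact_mapRange {ι : Type u} {M₁ M₂ M₃ : ι → Type u} [∀ i, AddCommGroup (M₁ i)]
    [∀ i, Module R (M₁ i)] [∀ i, AddCommGroup (M₂ i)] [∀ i, Module R (M₂ i)]
    [∀ i, AddCommGroup (M₃ i)] [∀ i, Module R (M₃ i)] {f : ∀ i, M₁ i →ₗ[R] M₂ i}
    {g : ∀ i, M₂ i →ₗ[R] M₃ i} (h : ∀ i, Function.Exact (f i) (g i)) :
    Function.Exact (DFinsupp.mapRange.linearMap f) (DFinsupp.mapRange.linearMap g) := by
  classical
  intro y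
  constructor
  · intro hy
    have hy' : ∀ i, ∃ x, f i x = y i := fun i => (h i _).1 (by simpa using DFunLike.congr_fun hy i)
    choose x hx using hy'
    refine ⟨DFinsupp.mk y.support fun i => x i, ?_⟩
    ext i
    by_cases hi : i ∈ y.support
    · simp [DFinsupp.mk_apply, hi, hx]
    · simp [DFinsupp.mk_apply, hi, DFinsupp.notMem_support_iff.1 hi]
  · rintro ⟨x, rfl⟩
    ext i
    simpa using (h i).apply_apply_eq_zero (x i)

/-- Syzygies commute with direct sums: the direct sum of free covers has as kernel the direct sum of
the kernels, so the bound descends to the projective case. -/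
theorem ProjDimLT.dfinsupp {ι : Type u} (n : ℕ) (M : ι → Type u) [∀ i, AddCommGroup (M i)]
    [∀ i, Module R (M i)] (h : ∀ i, ProjDimLT R (M i) (n + 1)) :
    ProjDimLT R (Π₀ i, M i) (n + 1) := by
  induction n generalizing M with
  | zero =>
    have (i : ι) : Module.Projective R (M i) := projDimLT_one_iff.1 (h i)
    exact projDimLT_of_projective 0
  | succ n ih =>
    let g (i : ι) : (M i →₀ R) →ₗ[R] M i := Finsupp.linearCombination R id
    have hg (i : ι) : Function.Surjective (g i) := Finsupp.linearCombination_id_surjective R (M i)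
    let f (i : ι) : LinearMap.ker (g i) →ₗ[R] (M i →₀ R) := (LinearMap.ker (g i)).subtype
    have hf (i : ι) : Function.Injective (f i) := Submodule.subtype_injective _
    have hfg (i : ι) : Function.Exact (f i) (g i) := LinearMap.exact_subtype_ker_map _
    have hK := ih (fun i => LinearMap.ker (g i)) fun i =>
      (projDimLT_right_iff (hf i) (hg i) (hfg i) n).1 (h i)
    have hF : Function.Injective (DFinsupp.mapRange.linearMap f) :=
      (DFinsupp.mapRange_injective _ fun _ => map_zero _).2 hf
    have hG : Function.Surjective (DFinsupp.mapRange.linearMap g) :=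
      (DFinsupp.mapRange_surjective _ fun _ => map_zero _).2 hg
    exact (projDimLT_right_iff hF hG (exact_mapRange hfg) n).2 hK

theorem ProjDimLT.finsupp {ι M : Type u} [AddCommGroup M] [Module R M] {n : ℕ}
    (h : ProjDimLT R M (n + 1)) : ProjDimLT R (ι →₀ M) (n + 1) := by
  classical
  exact (ProjDimLT.dfinsupp n (fun _ : ι => M) fun _ => h).of_linearEquiv
    (finsuppLequivDFinsupp R).symm

/-- If the quotient by a nilpotent two-sided ideal is semisimple, its projective dimension bounds
the projective dimensions of all modules. -/
theorem projDimLT_of_semisimple_quotient (J : Ideal R) [J.IsTwoSided] [IsSemisimpleRing (R ⧸ J)]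
    {m : ℕ} (hJ : J ^ m = ⊥) {n : ℕ} (h : ProjDimLT R (R ⧸ J) (n + 1)) (M : Type u)
    [AddCommGroup M] [Module R M] : ProjDimLT R M (n + 1) := by
  -- A module killed by `J` is a module over the semisimple ring `R ⧸ J`, hence projective there and
  -- a retract of a direct sum of copies of `R ⧸ J`.
  have killed (M : Type u) [AddCommGroup M] [Module R M]
      (hM : Module.IsTorsionBySet R M (J : Set R)) : ProjDimLT R M (n + 1) := by
    let := hM.module
    have : IsScalarTower R (R ⧸ J) M := hM.isScalarTower
    have : Module.Projective (R ⧸ J) M := Module.projective_of_isSemisimpleRing _ _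
    obtain ⟨s, hs⟩ := Module.projective_def'.1 this
    refine (ProjDimLT.finsupp (ι := M) h).of_retract (s.restrictScalars R)
      ((Finsupp.linearCombination (R ⧸ J) id).restrictScalars R) ?_
    ext x
    exact LinearMap.congr_fun hs x
  -- Induction on the length of the `J`-adic filtration, through `0 → JM → M → M/JM → 0`.
  have step (l : ℕ) : ∀ (M : Type u) [AddCommGroup M] [Module R M],
      (J ^ l) • (⊤ : Submodule R M) = ⊥ → ProjDimLT R M (n + 1) := by
    induction l with
    | zero =>
      intro M _ _ hM
      rw [Submodule.pow_zero, Ideal.one_eq_top] at hM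
      have : (⊤ : Submodule R M) = ⊥ := by
        rw [← hM]; exact (Submodule.top_smul _).symm
      have : Subsingleton M := (Submodule.subsingleton_iff R).1 (subsingleton_of_bot_eq_top this.symm)
      exact projDimLT_of_subsingleton _
    | succ l ih =>
      intro M _ _ hM
      let N : Submodule R M := J • ⊤
      refine ProjDimLT.middle (f := N.subtype) (g := N.mkQ) N.subtype_injective N.mkQ_surjective
        (LinearMap.exact_subtype_mkQ N) (ih N ?_) (killed _ ?_)
      · apply Submodule.map_injective_of_injective N.subtype_injective
        rw [Submodule.map_smul'', Submodule.map_bot, Submodule.map_top, Submodule.range_subtype,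
          ← hM, ← Submodule.mul_smul, ← Submodule.pow_succ]
      · intro x a
        obtain ⟨y, rfl⟩ := N.mkQ_surjective x
        rw [← map_smul]
        exact (Submodule.Quotient.mk_eq_zero _).2 (Submodule.smul_mem_smul a.2 trivial)
  exact step m M (by rw [hJ, Submodule.bot_smul])

end ProjectiveDimension

/-! ### Syzygies of left ideals generated by an abstract system of arrows. -/

section ArrowSystem

variable {R : Type u} [Ring R] {X : Type v}

/-- A family of elements `x a` of a ring, whose left annihilators are controlled by idempotents
`e a` and a relation `T`: the elements of `R (e a)` annihilating `x a` are the multiples of `x b`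
if `T a b`, and are zero if there is no such `b`. -/
structure IsArrowSystem (T : X → X → Prop) (e x : X → R) : Prop where
  idem : ∀ a, e a * e a = e a
  idem_mul : ∀ a, e a * x a = x a
  mul_idem : ∀ {a b}, T a b → x b * e a = x b
  mul_eq_zero : ∀ {a b}, T a b → x b * x a = 0
  exists_eq_mul : ∀ {a b}, T a b → ∀ z, z * e a = z → z * x a = 0 → ∃ w, z = w * x b
  eq_zero : ∀ {a}, (∀ b, ¬ T a b) → ∀ z, z * e a = z → z * x a = 0 → z = 0

theorem projective_span_idempotent {e : R} (he : e * e = e) :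
    Module.Projective R (Submodule.span R {e}) := by
  have key (z : Submodule.span R {e}) : (z : R) * e = z := by
    obtain ⟨r, hr⟩ := Submodule.mem_span_singleton.1 z.2
    rw [← hr, smul_eq_mul, mul_assoc, he]
  refine Module.Projective.of_split (Submodule.span R {e}).subtype
    ((LinearMap.toSpanSingleton R R e).codRestrict (Submodule.span R {e}) fun r =>
      Submodule.mem_span_singleton.2 ⟨r, rfl⟩) ?_
  ext z
  simp [key]

namespace IsArrowSystem

variable {T : X → X → Prop} {e x : X → R}

theorem mul_idem_of_mem (h : IsArrowSystem T e x) {a : X} {z : R}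
    (hz : z ∈ Submodule.span R {e a}) : z * e a = z := by
  obtain ⟨r, rfl⟩ := Submodule.mem_span_singleton.1 hz
  rw [smul_eq_mul, mul_assoc, h.idem]

end IsArrowSystem

/-- Right multiplication by `x`, from a left ideal to the left ideal generated by `x`. -/
def mulRightSpan (P : Submodule R R) (x : R) : P →ₗ[R] Submodule.span R {x} :=
  ((LinearMap.toSpanSingleton R R x).comp P.subtype).codRestrict _ fun z =>
    Submodule.mem_span_singleton.2 ⟨z, rfl⟩

@[simp]
theorem coe_mulRightSpan (P : Submodule R R) (x : R) (z : P) :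
    (mulRightSpan P x z : R) = z * x := rfl

namespace IsArrowSystem

variable {T : X → X → Prop} {e x : X → R}

theorem surjective_mulRightSpan (h : IsArrowSystem T e x) (a : X) :
    Function.Surjective (mulRightSpan (Submodule.span R {e a}) (x a)) := by
  rintro ⟨y, hy⟩
  obtain ⟨r, rfl⟩ := Submodule.mem_span_singleton.1 hy
  refine ⟨⟨r * e a, Submodule.mem_span_singleton.2 ⟨r, rfl⟩⟩, Subtype.ext ?_⟩
  simp [mul_assoc, h.idem_mul]

theorem span_le (h : IsArrowSystem T e x) {a b : X} (hab : T a b) :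
    Submodule.span R {x b} ≤ Submodule.span R {e a} :=
  (Submodule.span_singleton_le_iff_mem _ _).2
    (Submodule.mem_span_singleton.2 ⟨x b, h.mul_idem hab⟩)

theorem exact_mulRightSpan (h : IsArrowSystem T e x) {a b : X} (hab : T a b) :
    Function.Exact (Submodule.inclusion (h.span_le hab))
      (mulRightSpan (Submodule.span R {e a}) (x a)) := by
  intro z
  constructor
  · intro hz
    obtain ⟨w, hw⟩ := h.exists_eq_mul hab z (h.mul_idem_of_mem z.2) (congrArg Subtype.val hz)
    exact ⟨⟨z, Submodule.mem_span_singleton.2 ⟨w, hw.symm⟩⟩, rfl⟩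
  · rintro ⟨⟨y, hy⟩, rfl⟩
    obtain ⟨r, rfl⟩ := Submodule.mem_span_singleton.1 hy
    refine Subtype.ext ?_
    simp [mul_assoc, h.mul_eq_zero hab]

/-- Dimension shifting along `0 → R (x b) → R (e a) → R (x a) → 0`, whose middle term is projective.
-/
theorem projDimLT_iff (h : IsArrowSystem T e x) {a b : X} (hab : T a b) (n : ℕ) :
    ProjDimLT R (Submodule.span R {x a}) (n + 2) ↔ ProjDimLT R (Submodule.span R {x b}) (n + 1) :=
  have := projective_span_idempotent (h.idem a)
  projDimLT_right_iff (Submodule.inclusion_injective _) (h.surjective_mulRightSpan a)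
    (h.exact_mulRightSpan hab) n

theorem projective_of_forall_not (h : IsArrowSystem T e x) {a : X} (ha : ∀ b, ¬ T a b) :
    Module.Projective R (Submodule.span R {x a}) := by
  have := projective_span_idempotent (h.idem a)
  refine Module.Projective.of_equiv (LinearEquiv.ofBijective
    (mulRightSpan (Submodule.span R {e a}) (x a)) ⟨?_, h.surjective_mulRightSpan a⟩)
  rw [← LinearMap.ker_eq_bot, LinearMap.ker_eq_bot']
  intro z hz
  exact Subtype.ext (h.eq_zero ha z (h.mul_idem_of_mem z.2) (congrArg Subtype.val hz))

/-- If `T a b` and `R (x a)` is projective, then `x b = x b * r * x b` for some `r`. -/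
theorem exists_eq_mul_mul_of_projective (h : IsArrowSystem T e x) {a b : X} (hab : T a b)
    (ha : Module.Projective R (Submodule.span R {x a})) : ∃ r, x b = x b * r * x b := by
  obtain ⟨s, hs⟩ := Module.projective_lifting_property _ LinearMap.id (h.surjective_mulRightSpan a)
  have hs' (y) : mulRightSpan (Submodule.span R {e a}) (x a) (s y) = y := LinearMap.congr_fun hs y
  let E : Submodule.span R {e a} := ⟨e a, Submodule.mem_span_singleton_self _⟩
  -- For a section `s` of the projection, `e a - s (x a)` lies in the kernel, so it equals `r * x
  -- b`. Multiplying on the left by `x b` kills the term with `s`, because `x b * x a = 0`.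
  obtain ⟨⟨w, hw⟩, hw'⟩ := (h.exact_mulRightSpan hab
    (E - s (mulRightSpan (Submodule.span R {e a}) (x a) E))).1 (by rw [map_sub, hs', sub_self])
  obtain ⟨r, rfl⟩ := Submodule.mem_span_singleton.1 hw
  refine ⟨r, ?_⟩
  have hx : x b • E - s (mulRightSpan (Submodule.span R {e a}) (x a) (x b • E)) =
      x b • Submodule.inclusion (h.span_le hab) ⟨r • x b, hw⟩ := by
    rw [hw', smul_sub, map_smul, map_smul]
  have h0 : mulRightSpan (Submodule.span R {e a}) (x a) (x b • E) = 0 := by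
    refine Subtype.ext ?_
    simp [E, h.mul_idem hab, h.mul_eq_zero hab]
  rw [h0, map_zero, sub_zero] at hx
  have := congrArg Subtype.val hx
  simpa [E, h.mul_idem hab, mul_assoc] using this

/-- Each step along the cycle lowers the bound by one, until some `R (x a)` would be projective.
Then `x b = (x b * r) ^ l * x b` for all `l`, which vanishes for large `l` as `x b` lies in a
nilpotent ideal. -/
theorem not_projDimLT_of_cycle (h : IsArrowSystem T e x) {J : Ideal R} [J.IsTwoSided] {m : ℕ}
    (hJ : J ^ m = ⊥) (hx : ∀ a, x a ∈ J) (hx₀ : ∀ a, x a ≠ 0) {a : X} (ha : Relation.TransGen T a a) (n : ℕ) :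
    ¬ ProjDimLT R (Submodule.span R {x a}) (n + 1) := by
  induction n generalizing a with
  | zero =>
    intro hp
    obtain ⟨b, hab, -⟩ := Relation.TransGen.head'_iff.1 ha
    obtain ⟨r, hr⟩ := h.exists_eq_mul_mul_of_projective hab (projDimLT_one_iff.1 hp)
    have key (l : ℕ) : x b = (x b * r) ^ l * x b := by
      induction l with
      | zero => simp
      | succ l ih =>
        rw [pow_succ, mul_assoc, ← hr]
        exact ih
    apply hx₀ b
    have hm : (x b * r) ^ m ∈ J ^ m := Ideal.pow_mem_pow (J.mul_mem_right r (hx b)) m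
    rw [hJ, Submodule.mem_bot] at hm
    rw [key m, hm, zero_mul]
  | succ n ih =>
    intro hp
    obtain ⟨b, hab, hba⟩ := Relation.TransGen.head'_iff.1 ha
    exact ih (Relation.TransGen.tail' hba hab) ((h.projDimLT_iff hab n).1 hp)

/-- On a finite set an acyclic `T` has well-founded converse, so following successors stops at an
`a` without any, where `R (x a)` is projective. Finiteness then makes the bound uniform. -/
theorem exists_projDimLT_of_acyclic (h : IsArrowSystem T e x) [Finite X]
    (hT : ∀ a, ¬ Relation.TransGen T a a) :
    ∃ n, ∀ a, ProjDimLT R (Submodule.span R {x a}) (n + 1) := by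
  have : Std.Irrefl (Relation.TransGen (flip T)) := ⟨fun a ha => hT a (by
    rw [← Relation.transGen_swap] at ha
    exact ha)⟩
  have wf : WellFounded (Relation.TransGen (flip T)) := Finite.wellFounded_of_trans_of_irrefl _
  have key (a : X) : ∃ n, ProjDimLT R (Submodule.span R {x a}) (n + 1) := by
    induction a using wf.induction with
    | _ a ih =>
      by_cases hb : ∃ b, T a b
      · obtain ⟨b, hab⟩ := hb
        obtain ⟨n, hn⟩ := ih b (Relation.TransGen.single hab)
        exact ⟨n + 1, (h.projDimLT_iff hab n).2 hn⟩
      · exact ⟨0, projDimLT_one_iff.2 (h.projective_of_forall_not (not_exists.1 hb))⟩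
  choose n hn using key
  obtain ⟨N, hN⟩ := Set.finite_range n |>.bddAbove
  exact ⟨N, fun a => (hn a).mono (by have := hN ⟨a, rfl⟩; omega)⟩

end IsArrowSystem

/-- If a two-sided ideal `J` is the direct sum of the left ideals generated by the elements `x a`,
the projective dimensions of the latter bound the projective dimension of `R ⧸ J`. -/
theorem projDimLT_quotient_of_independent {X : Type v} [Fintype X] (x : X → R) (J : Ideal R)
    (hJ : ∀ z, z ∈ J ↔ ∃ w : X → R, z = ∑ a, w a * x a)
    (hx : ∀ w : X → R, ∑ a, w a * x a = 0 → ∀ a, w a * x a = 0) {n : ℕ}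
    (h : ∀ a, ProjDimLT R (Submodule.span R {x a}) (n + 1)) :
    ProjDimLT R (R ⧸ J) (n + 2) := by
  classical
  -- The direct sum must be indexed in the universe of `R`, as `ProjDimLT.dfinsupp` demands.
  let ι := ULift.{u} (Fin (Fintype.card X))
  let f : ι ≃ X := Equiv.ulift.trans (Fintype.equivFin X).symm
  let M (i : ι) : Submodule R R := Submodule.span R {x (f i)}
  let F : (Π₀ i, M i) →ₗ[R] R := ∑ i, (M i).subtype ∘ₗ DFinsupp.lapply i
  have hF (y : Π₀ i, M i) : F y = ∑ a, (y (f.symm a) : R) := by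
    rw [f.symm.sum_comp fun i => (y i : R)]
    simp [F, LinearMap.sum_apply]
  have hy (y : Π₀ i, M i) : ∃ w : X → R, ∀ a, (y (f.symm a) : R) = w a * x a := by
    have (a : X) : ∃ w, w • x (f (f.symm a)) = (y (f.symm a) : R) :=
      Submodule.mem_span_singleton.1 (y (f.symm a)).2
    choose w hw using this
    exact ⟨w, fun a => by rw [← hw]; simp⟩
  refine (projDimLT_right_iff (f := F) (g := J.mkQ) ?_ J.mkQ_surjective ?_ n).2
    (ProjDimLT.dfinsupp n _ fun i => h (f i))
  · rw [← LinearMap.ker_eq_bot, LinearMap.ker_eq_bot']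
    intro y hy₀
    obtain ⟨w, hw⟩ := hy y
    rw [hF] at hy₀
    simp only [hw] at hy₀
    ext i
    obtain ⟨a, rfl⟩ := f.symm.surjective i
    rw [hw, hx w hy₀ a]
    rfl
  · intro z
    rw [Submodule.mkQ_apply, Submodule.Quotient.mk_eq_zero, hJ]
    constructor
    · rintro ⟨w, rfl⟩
      let y : Π₀ i, M i := DFinsupp.equivFunOnFintype.symm fun i =>
        ⟨w (f i) * x (f i), Submodule.mem_span_singleton.2 ⟨_, rfl⟩⟩
      have hy (i : ι) : (y i : R) = w (f i) * x (f i) := rfl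
      refine ⟨y, ?_⟩
      rw [hF]
      simp only [hy, Equiv.apply_symm_apply]
    · rintro ⟨y, rfl⟩
      obtain ⟨w, hw⟩ := hy y
      exact ⟨w, by rw [hF]; simp only [hw]⟩

end ArrowSystem

/-! ### Paths as lists of arrows. -/

section PathArrows

variable {V : Type u} [Quiver.{v} V]

/-- All arrows of a quiver. -/
abbrev QArrow (V : Type u) [Quiver.{v} V] : Type (max u v) :=
  Σ a : V, Σ b : V, (a ⟶ b)

/-- The list of arrows of a path. -/
def pathArrows {a : V} : ∀ {b : V}, Quiver.Path a b → List (QArrow V)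
  | _, .nil => []
  | _, .cons p e => pathArrows p ++ [⟨_, _, e⟩]

@[simp]
theorem pathArrows_nil (a : V) : pathArrows (Quiver.Path.nil : Quiver.Path a a) = [] := rfl

@[simp]
theorem pathArrows_cons {a b c : V} (p : Quiver.Path a b) (e : b ⟶ c) :
    pathArrows (p.cons e) = pathArrows p ++ [⟨b, c, e⟩] := rfl

@[simp]
theorem pathArrows_toPath {a b : V} (e : a ⟶ b) : pathArrows e.toPath = [⟨a, b, e⟩] := rfl

@[simp]
theorem pathArrows_comp {a b c : V} (p : Quiver.Path a b) (q : Quiver.Path b c) :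
    pathArrows (p.comp q) = pathArrows p ++ pathArrows q := by
  induction q with
  | nil => simp
  | cons q e ih => simp [ih]

@[simp]
theorem length_pathArrows {a b : V} (p : Quiver.Path a b) : (pathArrows p).length = p.length := by
  induction p with
  | nil => rfl
  | cons p e ih => simp [ih]

theorem exists_eq_toPath_comp {a b : V} (p : Quiver.Path a b) (hp : p.length ≠ 0) :
    ∃ (c : V) (e : a ⟶ c) (q : Quiver.Path c b), p = e.toPath.comp q := by
  obtain ⟨c, e, q, h, -⟩ := (Quiver.Path.length_ne_zero_iff_eq_comp p).1 hp
  exact ⟨c, e, q, h⟩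

end PathArrows

/-! ### The ideal `I` is monomial: membership is read off from consecutive arrows. -/

namespace PathAlgebra

variable {k : Type w} [Field k] {V : Type u} [Quiver.{v} V]

variable (k) in
/-- The coefficient of a path in an element of the path algebra. -/
noncomputable def coeff (q : QPath V) : PathAlgebra k V →ₗ[k] k :=
  (Finsupp.lapply q : (QPath V →₀ k) →ₗ[k] k)

theorem coeff_ofPath_self {a b : V} (q : Quiver.Path a b) :
    coeff k ⟨a, b, q⟩ (ofPath k q) = 1 :=
  Finsupp.single_eq_same

theorem coeff_ofPath_of_ne {q : QPath V} {a b : V} {p : Quiver.Path a b} (h : q ≠ ⟨a, b, p⟩) :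
    coeff k q (ofPath k p) = 0 :=
  Finsupp.single_eq_of_ne h

variable (k) in
/-- The linear extension of a map defined on paths. -/
noncomputable def lift {M : Type*} [AddCommGroup M] [Module k M] (f : QPath V → M) :
    PathAlgebra k V →ₗ[k] M :=
  (Finsupp.linearCombination k f : (QPath V →₀ k) →ₗ[k] M)

theorem lift_ofPath {M : Type*} [AddCommGroup M] [Module k M] (f : QPath V → M) {a b : V}
    (p : Quiver.Path a b) : lift k f (ofPath k p) = f ⟨a, b, p⟩ := by
  unfold lift ofPath
  erw [Finsupp.linearCombination_single]
  simp

theorem ofArrow_mul_ofArrow {a b c : V} (e : a ⟶ b) (f : b ⟶ c) :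
    ofArrow k e * ofArrow k f = ofPath k (e.toPath.comp f.toPath) :=
  ofPath_mul_comp _ _

theorem ofPath_mul_ofArrow {a b c : V} (p : Quiver.Path a b) (f : b ⟶ c) :
    ofPath k p * ofArrow k f = ofPath k (p.cons f) :=
  ofPath_mul_comp _ _

section Ring

variable [Fintype V] {I : TwoSidedIdeal (PathAlgebra k V)}

theorem smul_mem_twoSidedIdeal (r : k) {x : PathAlgebra k V} (hx : x ∈ I) : r • x ∈ I := by
  rw [← one_mul x, ← smul_mul_assoc]
  exact I.mul_mem_left _ _ hx

/-- The product of the arrows `e` and `f` is a path which is nonzero modulo `I`. -/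
def NonzeroProd (I : TwoSidedIdeal (PathAlgebra k V)) (e f : QArrow V) : Prop :=
  ofArrow k e.2.2 * ofArrow k f.2.2 ∉ I

/-- The product of the arrows `e` and `f` is a path which is zero modulo `I`. -/
def IsRelation (I : TwoSidedIdeal (PathAlgebra k V)) (e f : QArrow V) : Prop :=
  e.2.1 = f.1 ∧ ofArrow k e.2.2 * ofArrow k f.2.2 ∈ I

theorem NonzeroProd.target_eq {e f : QArrow V} (h : NonzeroProd I e f) : e.2.1 = f.1 := by
  by_contra hne
  exact h (by rw [ofArrow, ofArrow, ofPath_mul_of_ne _ _ hne]; exact I.zero_mem)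

/-- The linear span of the paths in which the product of some consecutive arrows is in `I`. -/
noncomputable def relationSpan (I : TwoSidedIdeal (PathAlgebra k V)) : Submodule k (PathAlgebra k V) :=
  Submodule.span k {x | ∃ (a b : V) (q : Quiver.Path a b),
    ¬ (pathArrows q).IsChain (NonzeroProd I) ∧ ofPath k q = x}

theorem mul_mem_relationSpan (z : PathAlgebra k V) {x : PathAlgebra k V}
    (hx : x ∈ relationSpan I) : z * x ∈ relationSpan I := by
  induction hx using Submodule.span_induction with
  | mem x hx =>
    obtain ⟨a, b, q, hq, rfl⟩ := hx
    induction z using induction_on with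
    | zero => rw [zero_mul]; exact zero_mem _
    | add z₁ z₂ h₁ h₂ => rw [add_mul]; exact add_mem h₁ h₂
    | path r c d p =>
      rw [smul_mul_assoc]
      refine Submodule.smul_mem _ _ ?_
      by_cases h : d = a
      · subst h
        rw [ofPath_mul_comp]
        refine Submodule.subset_span ⟨_, _, _, fun hc => hq ?_, rfl⟩
        rw [pathArrows_comp] at hc
        exact hc.right_of_append
      · rw [ofPath_mul_of_ne _ _ h]; exact zero_mem _
  | zero => rw [mul_zero]; exact zero_mem _
  | add x y _ _ hx hy => rw [mul_add]; exact add_mem hx hy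
  | smul r x _ hx => rw [mul_smul_comm]; exact Submodule.smul_mem _ _ hx

theorem relationSpan_mul_mem (z : PathAlgebra k V) {x : PathAlgebra k V}
    (hx : x ∈ relationSpan I) : x * z ∈ relationSpan I := by
  induction hx using Submodule.span_induction with
  | mem x hx =>
    obtain ⟨a, b, q, hq, rfl⟩ := hx
    induction z using induction_on with
    | zero => rw [mul_zero]; exact zero_mem _
    | add z₁ z₂ h₁ h₂ => rw [mul_add]; exact add_mem h₁ h₂
    | path r c d p =>
      rw [mul_smul_comm]
      refine Submodule.smul_mem _ _ ?_
      by_cases h : b = c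
      · subst h
        rw [ofPath_mul_comp]
        refine Submodule.subset_span ⟨_, _, _, fun hc => hq ?_, rfl⟩
        rw [pathArrows_comp] at hc
        exact hc.left_of_append
      · rw [ofPath_mul_of_ne _ _ h]; exact zero_mem _
  | zero => rw [zero_mul]; exact zero_mem _
  | add x y _ _ hx hy => rw [add_mul]; exact add_mem hx hy
  | smul r x _ hx => rw [smul_mul_assoc]; exact Submodule.smul_mem _ _ hx

theorem ofPath_mem_of_not_isChain {a b : V} (q : Quiver.Path a b)
    (hq : ¬ (pathArrows q).IsChain (NonzeroProd I)) : ofPath k q ∈ I := by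
  induction q with
  | nil => simp at hq
  | cons q e ih =>
    by_cases hc : (pathArrows q).IsChain (NonzeroProd I)
    · cases q with
      | nil => simp at hq
      | cons q f =>
        -- The path without its last arrow is still a chain, so the failure occurs at the last
        -- joint.
        have hfe : ofArrow k f * ofArrow k e ∈ I := by
          by_contra hfe
          refine hq ?_
          rw [pathArrows_cons, List.isChain_append]
          refine ⟨hc, List.isChain_singleton _, ?_⟩
          intro x hx y hy
          simp only [pathArrows_cons, List.getLast?_append, List.getLast?_singleton,
            Option.some_or, Option.mem_def, Option.some.injEq, List.head?_cons] at hx hy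
          subst hx hy
          exact hfe
        rw [← ofPath_mul_ofArrow, ← ofPath_mul_ofArrow, mul_assoc]
        exact I.mul_mem_left _ _ hfe
    · rw [← ofPath_mul_ofArrow]
      exact I.mul_mem_right _ _ (ih hc)

/-- The span of the paths containing a zero product of consecutive arrows is a two-sided ideal, and
it contains the generators of `I` because they have length two. Hence elements of `I` have zero
coefficient at every path outside `I`. -/
theorem mem_iff_mem_relationSpan (hI : IsLocallyGentle I) {x : PathAlgebra k V} :
    x ∈ I ↔ x ∈ relationSpan I := by
  constructor
  · let W : TwoSidedIdeal (PathAlgebra k V) := .mk' (relationSpan I) (zero_mem _)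
      (fun hx hy => add_mem hx hy) (fun hx => neg_mem hx) (fun hx => mul_mem_relationSpan _ hx)
      (fun hx => relationSpan_mul_mem _ hx)
    suffices I ≤ W by
      intro hx
      have := this hx
      rwa [TwoSidedIdeal.mem_mk'] at this
    obtain ⟨S, hS, hIS⟩ := hI.generated
    rw [hIS, TwoSidedIdeal.span_le]
    rintro _ ⟨⟨a, b, q⟩, hq, rfl⟩
    have hqI : ofPath k q ∈ I := by
      rw [hIS]
      exact TwoSidedIdeal.subset_span ⟨_, hq, rfl⟩
    refine (TwoSidedIdeal.mem_mk' ..).2 (Submodule.subset_span ⟨_, _, q, fun hc => ?_, rfl⟩)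
    match q, hS _ hq with
    | .cons (.cons .nil e) f, _ =>
      simp only [pathArrows_cons, pathArrows_nil, List.nil_append, List.cons_append,
        List.isChain_pair] at hc
      exact hc (by rw [ofArrow_mul_ofArrow]; exact hqI)
  · intro hx
    induction hx using Submodule.span_induction with
    | mem x hx =>
      obtain ⟨a, b, q, hq, rfl⟩ := hx
      exact ofPath_mem_of_not_isChain q hq
    | zero => exact I.zero_mem
    | add x y _ _ hx hy => exact I.add_mem hx hy
    | smul r x _ hx => exact smul_mem_twoSidedIdeal r hx

theorem coeff_eq_zero_of_mem (hI : IsLocallyGentle I) {x : PathAlgebra k V} (hx : x ∈ I)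
    {a b : V} {q : Quiver.Path a b} (hq : (pathArrows q).IsChain (NonzeroProd I)) :
    coeff k ⟨a, b, q⟩ x = 0 := by
  rw [mem_iff_mem_relationSpan hI] at hx
  induction hx using Submodule.span_induction with
  | mem x hx =>
    obtain ⟨c, d, p, hp, rfl⟩ := hx
    refine coeff_ofPath_of_ne fun h => hp ?_
    cases h
    exact hq
  | zero => exact map_zero _
  | add x y _ _ hx hy => rw [map_add, hx, hy, add_zero]
  | smul r x _ hx => rw [map_smul, hx, smul_zero]

theorem ofPath_mem_iff (hI : IsLocallyGentle I) {a b : V} (q : Quiver.Path a b) :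
    ofPath k q ∈ I ↔ ¬ (pathArrows q).IsChain (NonzeroProd I) := by
  refine ⟨fun h hq => ?_, ofPath_mem_of_not_isChain q⟩
  have := coeff_eq_zero_of_mem hI h hq
  rw [coeff_ofPath_self] at this
  exact one_ne_zero this

/-- By the coefficient criterion the paths outside `I` stay linearly independent modulo `I`, and the
quotient is finite dimensional. -/
theorem finite_nonzero_paths (hI : IsGentle I) : {q : QPath V | ofPath k q.2.2 ∉ I}.Finite := by
  have := hI.finite_dimensional
  let f : QPath V → QuiverAlgebra I := fun q => (ofPath k q.2.2 : PathAlgebra k V)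
  have hf : LinearIndependent k fun q : {q : QPath V | ofPath k q.2.2 ∉ I} => f q := by
    rw [linearIndependent_iff']
    intro s c hc q hq
    let x : PathAlgebra k V := ∑ q ∈ s, c q • ofPath k q.1.2.2
    have hx : x ∈ I := by
      rw [TwoSidedIdeal.mem_iff, ← RingCon.eq]
      have hx' : I.ringCon.mk' x = ∑ q ∈ s, c q • f q := by
        rw [map_sum]
        rfl
      exact hx'.trans hc
    have := coeff_eq_zero_of_mem hI.toIsLocallyGentle hx
      (not_not.1 fun h => q.2 ((ofPath_mem_iff hI.toIsLocallyGentle _).2 h))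
    rw [map_sum, Finset.sum_eq_single q] at this
    · rwa [map_smul, coeff_ofPath_self, smul_eq_mul, mul_one] at this
    · intro p _ hpq
      rw [map_smul, coeff_ofPath_of_ne, smul_zero]
      intro h
      exact hpq (Subtype.ext h.symm)
    · exact fun h => absurd hq h
  exact Set.finite_coe_iff.1 hf.finite

end Ring

/-! ### Left division by an arrow. -/

section LeftDivision

open Classical in
variable (k) in
/-- The linear map removing the initial arrow `a` from the paths starting with `a`, and killing
all other paths. -/
noncomputable def leftDiv (a : QArrow V) : PathAlgebra k V →ₗ[k] PathAlgebra k V :=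
  lift k fun q => if h : ∃ q' : Σ d, Quiver.Path a.2.1 d,
    q = ⟨a.1, q'.1, a.2.2.toPath.comp q'.2⟩ then ofPath k h.choose.2 else 0

theorem leftDiv_ofPath_comp (a : QArrow V) {d : V} (q : Quiver.Path a.2.1 d) :
    leftDiv k a (ofPath k (a.2.2.toPath.comp q)) = ofPath k q := by
  have h : ∃ q' : Σ d, Quiver.Path a.2.1 d,
      (⟨a.1, d, a.2.2.toPath.comp q⟩ : QPath V) = ⟨a.1, q'.1, a.2.2.toPath.comp q'.2⟩ :=
    ⟨⟨d, q⟩, rfl⟩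
  rw [leftDiv, lift_ofPath, dif_pos h]
  have := h.choose_spec
  generalize h.choose = q' at this
  obtain ⟨d', q'⟩ := q'
  simp only [Sigma.mk.injEq, heq_eq_eq, true_and] at this
  obtain ⟨rfl, h'⟩ := this
  rw [heq_eq_eq, Quiver.Path.comp_inj_right] at h'
  rw [h']

theorem leftDiv_ofPath_of_ne (a : QArrow V) {b c d : V} (e : b ⟶ c) (q : Quiver.Path c d)
    (hne : a ≠ ⟨b, c, e⟩) : leftDiv k a (ofPath k (e.toPath.comp q)) = 0 := by
  rw [leftDiv, lift_ofPath, dif_neg]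
  rintro ⟨⟨d', q'⟩, h⟩
  apply hne
  have := congrArg (fun q : QPath V => (pathArrows q.2.2).head?) h
  simpa using this.symm

variable [Fintype V] {I : TwoSidedIdeal (PathAlgebra k V)}

theorem leftDiv_arrow_mul (a : QArrow V) (x : PathAlgebra k V) :
    leftDiv k a (ofArrow k a.2.2 * x) =
      ofPath k (Quiver.Path.nil : Quiver.Path a.2.1 a.2.1) * x := by
  induction x using induction_on with
  | zero => simp only [mul_zero, map_zero]
  | add x y hx hy => rw [mul_add, map_add, hx, hy, mul_add]
  | path r c d q =>
    rw [mul_smul_comm, mul_smul_comm, map_smul]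
    congr 1
    by_cases h : a.2.1 = c
    · subst h
      rw [ofArrow, ofPath_mul_comp, leftDiv_ofPath_comp, ofPath_mul_comp, Quiver.Path.nil_comp]
    · rw [ofArrow, ofPath_mul_of_ne _ _ h, map_zero, ofPath_mul_of_ne _ _ h]

theorem leftDiv_arrow_mul_of_ne {a b : QArrow V} (hab : a ≠ b) (x : PathAlgebra k V) :
    leftDiv k a (ofArrow k b.2.2 * x) = 0 := by
  induction x using induction_on with
  | zero => simp only [mul_zero, map_zero]
  | add x y hx hy => rw [mul_add, map_add, hx, hy, add_zero]
  | path r c d q =>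
    rw [mul_smul_comm, map_smul]
    by_cases h : b.2.1 = c
    · subst h
      rw [ofArrow, ofPath_mul_comp, leftDiv_ofPath_of_ne a _ _ hab, smul_zero]
    · rw [ofArrow, ofPath_mul_of_ne _ _ h, map_zero, smul_zero]

/-- When the initial arrow `a` of a path in `I` is removed, either a zero product survives, or the
only one was that of `a` with the next arrow `b`, and then the rest starts with `b`. The subspace
`P` is left free because it is used for the multiples of `b` modulo `I`, for `I` itself, and for the
elements `y` with `a y ∈ I`. -/
theorem leftDiv_mem (hI : IsLocallyGentle I) (a : QArrow V)
    (P : Submodule k (PathAlgebra k V)) (hP : ∀ y ∈ I, y ∈ P)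
    (hP' : ∀ b, IsRelation I a b → ∀ y, ofArrow k b.2.2 * y ∈ P) {x : PathAlgebra k V}
    (hx : x ∈ I) : leftDiv k a x ∈ P := by
  rw [mem_iff_mem_relationSpan hI] at hx
  induction hx using Submodule.span_induction with
  | zero => rw [map_zero]; exact zero_mem _
  | add x y _ _ hx hy => rw [map_add]; exact add_mem hx hy
  | smul r x _ hx => rw [map_smul]; exact Submodule.smul_mem _ _ hx
  | mem x hx =>
    obtain ⟨s, d, q, hq, rfl⟩ := hx
    by_cases hl : q.length = 0
    · cases q with
      | nil => simp at hq
      | cons => simp at hl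
    obtain ⟨t, e, q, rfl⟩ := exists_eq_toPath_comp q hl
    by_cases ha : a = ⟨s, t, e⟩
    · subst ha
      rw [leftDiv_ofPath_comp ⟨s, t, e⟩]
      by_cases hq' : (pathArrows q).IsChain (NonzeroProd I)
      · by_cases hl : q.length = 0
        · cases q with
          | nil => simp at hq
          | cons => simp at hl
        obtain ⟨c, f, q, rfl⟩ := exists_eq_toPath_comp q hl
        rw [← ofPath_mul_comp]
        refine hP' ⟨t, c, f⟩ ⟨rfl, ?_⟩ _
        by_contra hef
        refine hq ?_
        simp only [pathArrows_comp, pathArrows_toPath, List.singleton_append] at hq' ⊢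
        exact hq'.cons_cons hef
      · exact hP _ (ofPath_mem_of_not_isChain q hq')
    · rw [leftDiv_ofPath_of_ne a _ _ ha]
      exact zero_mem _

end LeftDivision

/-! ### The augmentation onto `V → k`. -/

section Augmentation

open Classical in
theorem coeff_nil_ofPath {a b : V} (p : Quiver.Path a b) (c : V) :
    coeff k ⟨c, c, .nil⟩ (ofPath k p) = if p.length = 0 ∧ a = c then 1 else 0 := by
  split_ifs with h
  · obtain ⟨h, rfl⟩ := h
    cases p with
    | nil => exact coeff_ofPath_self _
    | cons => simp at h
  · refine coeff_ofPath_of_ne fun h' => h ?_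
    cases h'
    exact ⟨rfl, rfl⟩

variable [Fintype V]

/-- A product of two paths is trivial only if both factors are. -/
theorem coeff_nil_mul (x y : PathAlgebra k V) (c : V) :
    coeff k ⟨c, c, .nil⟩ (x * y) = coeff k ⟨c, c, .nil⟩ x * coeff k ⟨c, c, .nil⟩ y := by
  classical
  induction x using induction_on with
  | zero => simp only [zero_mul, map_zero]
  | add x x' hx hx' => rw [add_mul, map_add, hx, hx', map_add, add_mul]
  | path r a b p =>
    rw [smul_mul_assoc, map_smul, map_smul, smul_mul_assoc]
    congr 1
    induction y using induction_on with
    | zero => simp only [mul_zero, map_zero]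
    | add y y' hy hy' => rw [mul_add, map_add, hy, hy', map_add, mul_add]
    | path r' a' b' q =>
      rw [mul_smul_comm, map_smul, map_smul, mul_smul_comm]
      congr 1
      by_cases h : b = a'
      · subst h
        rw [ofPath_mul_comp, coeff_nil_ofPath, coeff_nil_ofPath, coeff_nil_ofPath]
        by_cases hp : p.length = 0
        · obtain rfl := p.eq_of_length_zero hp
          by_cases hc : a = c <;> simp [hp, hc]
        · simp [hp]
      · rw [ofPath_mul_of_ne _ _ h, map_zero, coeff_nil_ofPath, coeff_nil_ofPath]
        by_cases hp : p.length = 0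
        · obtain rfl := p.eq_of_length_zero hp
          by_cases hc : a = c
          · subst hc
            simp [hp, Ne.symm h]
          · simp [hc]
        · simp [hp]

variable (k V) in
/-- The algebra homomorphism killing all paths of positive length. -/
noncomputable def augmentation : PathAlgebra k V →+* (V → k) where
  toFun x c := coeff k ⟨c, c, .nil⟩ x
  map_one' := by
    classical
    ext c
    simp only [one_eq, map_sum, coeff_nil_ofPath, Pi.one_apply]
    simp
  map_mul' x y := funext fun c => coeff_nil_mul x y c
  map_zero' := funext fun c => map_zero _
  map_add' x y := funext fun c => map_add _ x y

theorem augmentation_apply (x : PathAlgebra k V) (c : V) :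
    augmentation k V x c = coeff k ⟨c, c, .nil⟩ x := rfl

theorem augmentation_eq_zero_of_mem {I : TwoSidedIdeal (PathAlgebra k V)} (hI : IsLocallyGentle I)
    {x : PathAlgebra k V} (hx : x ∈ I) : augmentation k V x = 0 :=
  funext fun _ => coeff_eq_zero_of_mem hI hx (by simp)

theorem augmentation_ofArrow (a : QArrow V) : augmentation k V (ofArrow k a.2.2) = 0 := by
  classical
  ext c
  rw [augmentation_apply, ofArrow, coeff_nil_ofPath]
  simp

theorem augmentation_surjective : Function.Surjective (augmentation k V) := by
  classical
  intro f
  refine ⟨∑ c, f c • ofPath k (Quiver.Path.nil : Quiver.Path c c), funext fun c => ?_⟩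
  rw [augmentation_apply, map_sum]
  simp [coeff_nil_ofPath]

theorem eq_sum_nil_add_sum_arrow [Fintype (QArrow V)] (x : PathAlgebra k V) :
    ∃ w : QArrow V → PathAlgebra k V,
      x = ∑ c, augmentation k V x c • ofPath k (Quiver.Path.nil : Quiver.Path c c) +
        ∑ a, ofArrow k a.2.2 * w a := by
  classical
  induction x using induction_on with
  | zero => exact ⟨0, by simp⟩
  | add x y hx hy =>
    obtain ⟨w, hw⟩ := hx
    obtain ⟨w', hw'⟩ := hy
    refine ⟨w + w', ?_⟩
    simp only [map_add, Pi.add_apply, add_smul, mul_add, Finset.sum_add_distrib]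
    nth_rewrite 1 [hw, hw']
    abel
  | path r a b p =>
    by_cases hp : p.length = 0
    · cases p with
      | nil =>
        refine ⟨0, ?_⟩
        simp only [augmentation_apply, map_smul, coeff_nil_ofPath]
        simp
      | cons => simp at hp
    · obtain ⟨c, e, q, rfl⟩ := exists_eq_toPath_comp p hp
      refine ⟨Pi.single ⟨a, c, e⟩ (r • ofPath k q), ?_⟩
      rw [Finset.sum_eq_zero, zero_add, Finset.sum_eq_single ⟨a, c, e⟩]
      · rw [Pi.single_eq_same, mul_smul_comm, ofArrow, ofPath_mul_comp]
      · intro f _ hf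
        rw [Pi.single_eq_of_ne hf, mul_zero]
      · exact fun h => absurd (Finset.mem_univ _) h
      · intro d _
        rw [augmentation_apply, map_smul, coeff_nil_ofPath, if_neg fun h => hp h.1, smul_zero,
          zero_smul]

end Augmentation

/-! ### The filtration by path length. -/

variable (k V) in
/-- The span of the paths of length at least `m`. -/
noncomputable def lengthGE (m : ℕ) : Submodule k (PathAlgebra k V) :=
  Submodule.span k {x | ∃ (a b : V) (q : Quiver.Path a b), m ≤ q.length ∧ ofPath k q = x}

theorem mem_lengthGE_zero (x : PathAlgebra k V) : x ∈ lengthGE k V 0 := by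
  induction x using induction_on with
  | zero => exact zero_mem _
  | add x y hx hy => exact add_mem hx hy
  | path r a b p => exact Submodule.smul_mem _ _ (Submodule.subset_span ⟨a, b, p, Nat.zero_le _, rfl⟩)

theorem ofArrow_mem_lengthGE (a : QArrow V) : ofArrow k a.2.2 ∈ lengthGE k V 1 :=
  Submodule.subset_span ⟨_, _, a.2.2.toPath, le_rfl, rfl⟩

variable [Fintype V] {I : TwoSidedIdeal (PathAlgebra k V)}

theorem mul_mem_lengthGE {m n : ℕ} {x y : PathAlgebra k V} (hx : x ∈ lengthGE k V m)
    (hy : y ∈ lengthGE k V n) : x * y ∈ lengthGE k V (m + n) := by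
  induction hx using Submodule.span_induction with
  | zero => rw [zero_mul]; exact zero_mem _
  | add x x' _ _ hx hx' => rw [add_mul]; exact add_mem hx hx'
  | smul r x _ hx => rw [smul_mul_assoc]; exact Submodule.smul_mem _ _ hx
  | mem x hx =>
    obtain ⟨a, b, p, hp, rfl⟩ := hx
    induction hy using Submodule.span_induction with
    | zero => rw [mul_zero]; exact zero_mem _
    | add y y' _ _ hy hy' => rw [mul_add]; exact add_mem hy hy'
    | smul r y _ hy => rw [mul_smul_comm]; exact Submodule.smul_mem _ _ hy
    | mem y hy =>
      obtain ⟨c, d, q, hq, rfl⟩ := hy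
      by_cases h : b = c
      · subst h
        rw [ofPath_mul_comp]
        exact Submodule.subset_span ⟨_, _, _, by rw [Quiver.Path.length_comp]; omega, rfl⟩
      · rw [ofPath_mul_of_ne _ _ h]
        exact zero_mem _

theorem exists_lengthGE_le (hI : IsGentle I) : ∃ m, ∀ x ∈ lengthGE k V m, x ∈ I := by
  obtain ⟨m, hm⟩ := ((finite_nonzero_paths hI).image fun q => q.2.2.length).bddAbove
  refine ⟨m + 1, fun x hx => ?_⟩
  induction hx using Submodule.span_induction with
  | zero => exact I.zero_mem
  | add x y _ _ hx hy => exact I.add_mem hx hy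
  | smul r x _ hx => exact smul_mem_twoSidedIdeal r hx
  | mem x hx =>
    obtain ⟨a, b, q, hq, rfl⟩ := hx
    by_contra h
    have := hm ⟨⟨a, b, q⟩, h, rfl⟩
    simp only at this
    omega

theorem IsRelation.right_unique (hI : IsLocallyGentle I) {a b c : QArrow V}
    (hb : IsRelation I a b) (hc : IsRelation I a c) : b = c := by
  obtain ⟨s, t, e⟩ := a
  obtain ⟨_, b⟩ := b
  obtain ⟨_, c⟩ := c
  obtain ⟨rfl : t = _, hb⟩ := hb
  obtain ⟨rfl : t = _, hc⟩ := hc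
  exact congrArg (Sigma.mk t) (hI.right_mem s t e hb hc)

theorem NonzeroProd.right_unique (hI : IsLocallyGentle I) {a b c : QArrow V}
    (hb : NonzeroProd I a b) (hc : NonzeroProd I a c) : b = c := by
  have h₁ := hb.target_eq
  have h₂ := hc.target_eq
  obtain ⟨s, t, e⟩ := a
  obtain ⟨_, b⟩ := b
  obtain ⟨_, c⟩ := c
  obtain rfl : t = _ := h₁
  obtain rfl : t = _ := h₂
  exact congrArg (Sigma.mk t) (hI.right_not_mem s t e hb hc)

theorem NonzeroProd.left_unique (hI : IsLocallyGentle I) {a b c : QArrow V}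
    (hb : NonzeroProd I b a) (hc : NonzeroProd I c a) : b = c := by
  have h₁ := hb.target_eq
  have h₂ := hc.target_eq
  obtain ⟨s, t, e⟩ := a
  obtain ⟨b, _, f⟩ := b
  obtain ⟨c, _, g⟩ := c
  dsimp only at h₁ h₂
  subst h₁ h₂
  exact congrArg (fun x : Σ c : V, (c ⟶ _) => (⟨x.1, _, x.2⟩ : QArrow V))
    (hI.left_not_mem _ t e (x := ⟨b, f⟩) hb (y := ⟨c, g⟩) hc)

open MulOpposite

/-! ### The arrow system, the augmentation and the length filtration in `Aᵐᵒᵖ`. -/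

section Quotient

variable {A : Type u'} [Ring A] {θ : PathAlgebra k V →+* A}

/-- In `Aᵐᵒᵖ` the left ideal generated by an arrow `a` is the right ideal `aA`, and the idempotent
is the trivial path at the target of `a`. If `a y ∈ I`, left division by `a` shows that `e y` lies
in `bA` modulo `I`, or in `I` if no relation starts with `a`. -/
theorem isArrowSystem (hI : IsLocallyGentle I) (hθ : Function.Surjective θ)
    (hker : ∀ x, θ x = 0 ↔ x ∈ I) :
    IsArrowSystem (IsRelation I)
      (fun a => op (θ (ofPath k (Quiver.Path.nil : Quiver.Path a.2.1 a.2.1))))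
      (fun a => op (θ (ofArrow k a.2.2))) where
  idem a := by rw [← op_mul, ← map_mul, ofPath_mul_comp, Quiver.Path.nil_comp]
  idem_mul a := by rw [← op_mul, ← map_mul, ofArrow, ofPath_mul_comp, Quiver.Path.comp_nil]
  mul_idem {a b} h := by
    obtain ⟨s, t, e⟩ := a
    obtain ⟨s', t', e'⟩ := b
    obtain ⟨rfl : t = s', -⟩ := h
    rw [← op_mul, ← map_mul, ofArrow, ofPath_mul_comp, Quiver.Path.nil_comp]
  mul_eq_zero {a b} h := by
    rw [← op_mul, ← map_mul, (hker _).2 h.2, op_zero]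
  exists_eq_mul {a b} h z hz hz' := by
    obtain ⟨y, hy⟩ := hθ z.unop
    obtain rfl : z = op (θ y) := by rw [hy, op_unop]
    rw [← op_mul, ← map_mul, op_eq_zero_iff, hker] at hz'
    rw [← op_mul, ← map_mul] at hz
    let P : Submodule k (PathAlgebra k V) :=
      { carrier := {x | ∃ w, x - ofArrow k b.2.2 * w ∈ I}
        zero_mem' := ⟨0, by rw [mul_zero, sub_zero]; exact I.zero_mem⟩
        add_mem' := by
          rintro x x' ⟨w, hw⟩ ⟨w', hw'⟩
          exact ⟨w + w', by rw [mul_add, add_sub_add_comm]; exact I.add_mem hw hw'⟩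
        smul_mem' := by
          rintro r x ⟨w, hw⟩
          exact ⟨r • w, by rw [mul_smul_comm, ← smul_sub]; exact smul_mem_twoSidedIdeal r hw⟩ }
    obtain ⟨w, hw⟩ := leftDiv_mem hI a P (fun y hy => ⟨0, by rwa [mul_zero, sub_zero]⟩)
      (fun c hc y => ⟨y, by rw [h.right_unique hI hc, sub_self]; exact I.zero_mem⟩) hz'
    rw [leftDiv_arrow_mul, ← hker, map_sub, sub_eq_zero] at hw
    exact ⟨op (θ w), by rw [← hz, hw, ← op_mul, ← map_mul]⟩
  eq_zero {a} h z hz hz' := by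
    obtain ⟨y, hy⟩ := hθ z.unop
    obtain rfl : z = op (θ y) := by rw [hy, op_unop]
    rw [← op_mul, ← map_mul, op_eq_zero_iff, hker] at hz'
    rw [← op_mul, ← map_mul] at hz
    have := leftDiv_mem hI a (relationSpan I) (fun y hy => (mem_iff_mem_relationSpan hI).1 hy)
      (fun b hb => absurd hb (h b)) hz'
    rw [leftDiv_arrow_mul, ← mem_iff_mem_relationSpan hI, ← hker] at this
    rw [← hz, this, op_zero]

/-- The sum of the right ideals `aA` is direct: left division by `a` kills all terms but that of
`a`, and sends `I` into the elements annihilated by `a` modulo `I`. -/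
theorem ofArrow_mul_mem_of_sum_mem (hI : IsLocallyGentle I) [Fintype (QArrow V)]
    (w : QArrow V → PathAlgebra k V) (hw : ∑ a : QArrow V, ofArrow k a.2.2 * w a ∈ I)
    (a : QArrow V) : ofArrow k a.2.2 * w a ∈ I := by
  let P : Submodule k (PathAlgebra k V) :=
    { carrier := {x | ofArrow k a.2.2 * x ∈ I}
      zero_mem' := by simp
      add_mem' := fun {x y} hx hy => by
        simpa only [Set.mem_ofPred_eq, mul_add] using! I.add_mem hx hy
      smul_mem' := fun r x hx => by
        simpa only [Set.mem_ofPred_eq, mul_smul_comm] using! smul_mem_twoSidedIdeal r hx }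
  have := leftDiv_mem hI a P (fun y hy => I.mul_mem_left _ _ hy) (fun b hb y => by
    change _ * _ ∈ I
    rw [← mul_assoc]
    exact I.mul_mem_right _ _ hb.2) hw
  rw [map_sum, Finset.sum_eq_single a, leftDiv_arrow_mul] at this
  · change _ * _ ∈ I at this
    rwa [← mul_assoc, ofArrow, ofPath_mul_comp, Quiver.Path.comp_nil] at this
  · exact fun b _ hb => leftDiv_arrow_mul_of_ne (Ne.symm hb) _
  · exact fun h => absurd (Finset.mem_univ _) h

/-- The homomorphism from the opposite of the quotient of a path algebra by a relation ideal to
its semisimple quotient. -/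
theorem exists_augmentation (hI : IsLocallyGentle I) (hθ : Function.Surjective θ)
    (hker : ∀ x, θ x = 0 ↔ x ∈ I) :
    ∃ ε : Aᵐᵒᵖ →+* (V → k), ∀ x, ε (op (θ x)) = augmentation k V x := by
  have hle : RingHom.ker θ ≤ RingHom.ker (augmentation k V) := fun x hx => by
    rw [RingHom.mem_ker] at hx ⊢
    exact augmentation_eq_zero_of_mem hI ((hker x).1 hx)
  let ε : A →+* (V → k) := θ.liftOfSurjective hθ ⟨augmentation k V, hle⟩
  have hε (x) : ε (θ x) = augmentation k V x :=
    θ.liftOfRightInverse_comp_apply _ (Function.rightInverse_surjInv hθ)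
      ⟨augmentation k V, hle⟩ x
  exact ⟨ε.fromOpposite fun x y => Commute.all _ _, fun x => hε x⟩

/-- The left ideal of the opposite algebra spanned by the paths of length at least `m`. -/
noncomputable def lengthIdeal (hθ : Function.Surjective θ) (m : ℕ) : Ideal Aᵐᵒᵖ where
  carrier := {z | ∃ x ∈ lengthGE k V m, z = op (θ x)}
  zero_mem' := ⟨0, zero_mem _, by rw [map_zero, op_zero]⟩
  add_mem' := by
    rintro _ _ ⟨x, hx, rfl⟩ ⟨y, hy, rfl⟩
    exact ⟨x + y, add_mem hx hy, by rw [map_add, op_add]⟩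
  smul_mem' := by
    rintro z _ ⟨x, hx, rfl⟩
    obtain ⟨y, hy⟩ := hθ z.unop
    have hz : z = op (θ y) := by rw [hy, op_unop]
    have hxy := mul_mem_lengthGE hx (mem_lengthGE_zero y)
    rw [add_zero] at hxy
    exact ⟨x * y, hxy, by rw [hz, map_mul, op_mul, smul_eq_mul]⟩

theorem pow_le_lengthIdeal (hθ : Function.Surjective θ) {J : Ideal Aᵐᵒᵖ}
    (hJ : J ≤ lengthIdeal hθ 1) (m : ℕ) : J ^ m ≤ lengthIdeal hθ m := by
  induction m with
  | zero =>
    intro z _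
    obtain ⟨y, hy⟩ := hθ z.unop
    exact ⟨y, mem_lengthGE_zero y, by rw [hy, op_unop]⟩
  | succ m ih =>
    rw [Submodule.pow_succ, Ideal.mul_le]
    intro r hr s hs
    obtain ⟨x, hx, rfl⟩ := ih hr
    obtain ⟨y, hy, rfl⟩ := hJ hs
    -- The factors are swapped because the product is taken in the opposite ring.
    exact ⟨y * x, by rw [add_comm]; exact mul_mem_lengthGE hy hx, by rw [map_mul, op_mul]⟩

end Quotient

theorem finite_qArrow (hI : IsLocallyGentle I) : Finite (QArrow V) := by
  have := hI.finite_arrows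
  infer_instance

end PathAlgebra

/-! ### Finite global dimension means no cycle of relations. -/

section GlobalDimension

open PathAlgebra MulOpposite CategoryTheory

variable {k : Type w} [Field k] {V : Type u} [Quiver.{v} V] [Fintype V]
  {I : TwoSidedIdeal (PathAlgebra k V)} {A : Type u'} [Ring A] {θ : PathAlgebra k V →+* A}

theorem mem_ker_augmentation_iff [Fintype (QArrow V)] (hθ : Function.Surjective θ)
    {ε : Aᵐᵒᵖ →+* (V → k)} (hε : ∀ x, ε (op (θ x)) = augmentation k V x) (z : Aᵐᵒᵖ) :
    z ∈ RingHom.ker ε ↔ ∃ w : QArrow V → Aᵐᵒᵖ, z = ∑ a, w a * op (θ (ofArrow k a.2.2)) := by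
  constructor
  · intro hz
    obtain ⟨y, hy⟩ := hθ z.unop
    obtain rfl : z = op (θ y) := by rw [hy, op_unop]
    obtain ⟨w, hw⟩ := eq_sum_nil_add_sum_arrow y
    rw [RingHom.mem_ker, hε] at hz
    rw [hz] at hw
    simp only [Pi.zero_apply, zero_smul, Finset.sum_const_zero, zero_add] at hw
    refine ⟨fun a => op (θ (w a)), ?_⟩
    rw [hw, map_sum, Finset.op_sum]
    simp only [map_mul, op_mul]
  · rintro ⟨w, rfl⟩
    refine Submodule.sum_mem _ fun a _ => (RingHom.ker ε).mul_mem_left _ ?_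
    rw [RingHom.mem_ker, hε, augmentation_ofArrow]

theorem exists_ker_augmentation_pow_eq_bot (hI : IsGentle I) (hθ : Function.Surjective θ)
    (hker : ∀ x, θ x = 0 ↔ x ∈ I) {ε : Aᵐᵒᵖ →+* (V → k)}
    (hε : ∀ x, ε (op (θ x)) = augmentation k V x) : ∃ m, RingHom.ker ε ^ m = ⊥ := by
  have := finite_qArrow hI.toIsLocallyGentle
  have := Fintype.ofFinite (QArrow V)
  have hJ₁ : RingHom.ker ε ≤ lengthIdeal hθ 1 := by
    intro z hz
    obtain ⟨w, rfl⟩ := (mem_ker_augmentation_iff hθ hε z).1 hz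
    exact Submodule.sum_mem _ fun a _ => Ideal.mul_mem_left _ _
      ⟨_, ofArrow_mem_lengthGE a, rfl⟩
  obtain ⟨m, hm⟩ := exists_lengthGE_le hI
  refine ⟨m, ?_⟩
  rw [eq_bot_iff]
  intro z hz
  obtain ⟨x, hx, rfl⟩ := pow_le_lengthIdeal hθ hJ₁ m hz
  rw [Submodule.mem_bot, (hker x).2 (hm x hx), op_zero]

/-- The right ideal generated by an arrow on a cycle of relations has infinite projective dimension.
-/
theorem acyclic_of_globalDimension_lt_top (hI : IsGentle I) (hθ : Function.Surjective θ)
    (hker : ∀ x, θ x = 0 ↔ x ∈ I) (h : globalDimension A < ⊤) (a : QArrow V) :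
    ¬ Relation.TransGen (IsRelation I) a a := by
  intro ha
  have sys := isArrowSystem hI.toIsLocallyGentle hθ hker
  obtain ⟨ε, hε⟩ := exists_augmentation hI.toIsLocallyGentle hθ hker
  obtain ⟨m, hm⟩ := exists_ker_augmentation_pow_eq_bot hI hθ hker hε
  have hx (a : QArrow V) : op (θ (ofArrow k a.2.2)) ∈ RingHom.ker ε := by
    rw [RingHom.mem_ker, hε, augmentation_ofArrow]
  have hx₀ (a : QArrow V) : op (θ (ofArrow k a.2.2)) ≠ 0 := by
    rw [ne_eq, op_eq_zero_iff, hker, ofArrow, ofPath_mem_iff hI.toIsLocallyGentle]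
    simp
  let M : ModuleCat.{u'} Aᵐᵒᵖ :=
    ModuleCat.of Aᵐᵒᵖ (Submodule.span Aᵐᵒᵖ {op (θ (ofArrow k a.2.2))})
  have hM : projectiveDimension M ≤ globalDimension A :=
    le_iSup (fun M : ModuleCat.{u'} Aᵐᵒᵖ => projectiveDimension M) M
  obtain ⟨n, hn⟩ := (projectiveDimension_ne_top_iff M).1 (hM.trans_lt h).ne
  exact sys.not_projDimLT_of_cycle hm hx hx₀ ha n hn

/-- The kernel of the augmentation is nilpotent with semisimple quotient, and is the direct sum of
the right ideals of the arrows, whose projective dimensions are bounded. The quotient then bounds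
all modules. -/
theorem globalDimension_lt_top_of_acyclic (hI : IsGentle I) (hθ : Function.Surjective θ)
    (hker : ∀ x, θ x = 0 ↔ x ∈ I) (h : ∀ a, ¬ Relation.TransGen (IsRelation I) a a) :
    globalDimension A < ⊤ := by
  have sys := isArrowSystem hI.toIsLocallyGentle hθ hker
  have := finite_qArrow hI.toIsLocallyGentle
  have := Fintype.ofFinite (QArrow V)
  obtain ⟨ε, hε⟩ := exists_augmentation hI.toIsLocallyGentle hθ hker
  obtain ⟨m, hm⟩ := exists_ker_augmentation_pow_eq_bot hI hθ hker hε
  have hε' : Function.Surjective ε := fun f => by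
    obtain ⟨x, rfl⟩ := augmentation_surjective (k := k) f
    exact ⟨_, hε x⟩
  have : IsSemisimpleRing (Aᵐᵒᵖ ⧸ RingHom.ker ε) :=
    (RingHom.quotientKerEquivOfSurjective hε').symm.isSemisimpleRing
  obtain ⟨n, hn⟩ := sys.exists_projDimLT_of_acyclic h
  have hq : ProjDimLT Aᵐᵒᵖ (Aᵐᵒᵖ ⧸ RingHom.ker ε) (n + 2) := by
    have hJ := mem_ker_augmentation_iff hθ hε
    refine projDimLT_quotient_of_independent (R := Aᵐᵒᵖ) (X := QArrow V)
      (fun a => op (θ (ofArrow k a.2.2))) (RingHom.ker ε) hJ ?_ hn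
    intro w hw a
    choose y hy using fun a => hθ (w a).unop
    have hwy (a) : w a * op (θ (ofArrow k a.2.2)) = op (θ (ofArrow k a.2.2 * y a)) := by
      rw [map_mul, hy, op_mul, op_unop]
    simp only [hwy, ← Finset.op_sum, ← map_sum, op_eq_zero_iff, hker] at hw ⊢
    exact ofArrow_mul_mem_of_sum_mem hI.toIsLocallyGentle y hw a
  have hle : globalDimension A ≤ ((n + 1 : ℕ) : WithBot ℕ∞) := iSup_le fun M =>
    (projectiveDimension_le_iff M (n + 1)).2
      (projDimLT_of_semisimple_quotient (RingHom.ker ε) hm (n := n + 1) hq M)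
  exact hle.trans_lt (WithBot.coe_lt_coe.2 (ENat.natCast_lt_top (n + 1)))

/-- A gentle algebra has finite global dimension if and only if it has no cycle with full
relations. -/
theorem globalDimension_lt_top_iff (hI : IsGentle I) [Algebra k A] (φ : A ≃ₐ[k] QuiverAlgebra I) :
    globalDimension A < ⊤ ↔ ∀ a, ¬ Relation.TransGen (IsRelation I) a a := by
  let θ : PathAlgebra k V →+* A := (φ.symm : QuiverAlgebra I →+* A).comp I.ringCon.mk'
  have hθ : Function.Surjective θ := φ.symm.surjective.comp I.ringCon.mk'_surjective
  have hker (x) : θ x = 0 ↔ x ∈ I := by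
    rw [TwoSidedIdeal.mem_iff, ← RingCon.eq]
    exact map_eq_zero_iff φ.symm φ.symm.injective
  exact ⟨acyclic_of_globalDimension_lt_top hI hθ hker,
    globalDimension_lt_top_of_acyclic hI hθ hker⟩

end GlobalDimension

/-! ### The permutation exchanging the two visits to a vertex. -/

section CoincidencePerm

variable {V : Type u}

/-- `α` exchanges the indices at which `x` takes the same value. -/
def IsCoincidencePerm {l : ℕ} (x : Fin (l + 1) → V) (α : Equiv.Perm (Fin (l + 1))) : Prop :=
  ∀ i, (∀ j, j ≠ i → x j = x i → α i = j) ∧ ((¬ ∃ j, j ≠ i ∧ x j = x i) → α i = i)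

namespace IsCoincidencePerm

variable {l : ℕ} {x : Fin (l + 1) → V} {α : Equiv.Perm (Fin (l + 1))}

theorem involutive (hα : IsCoincidencePerm x α) : Function.Involutive α := by
  intro i
  by_cases h : ∃ j, j ≠ i ∧ x j = x i
  · obtain ⟨j, hj, hx⟩ := h
    rw [(hα i).1 j hj hx, (hα j).1 i hj.symm hx.symm]
  · rw [(hα i).2 h, (hα i).2 h]

theorem vertex_eq (hα : IsCoincidencePerm x α) (i : Fin (l + 1)) : x (α i) = x i := by
  by_cases h : ∃ j, j ≠ i ∧ x j = x i
  · obtain ⟨j, hj, hx⟩ := h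
    rw [(hα i).1 j hj hx, hx]
  · rw [(hα i).2 h]

theorem unique {β : Equiv.Perm (Fin (l + 1))} (hα : IsCoincidencePerm x α)
    (hβ : IsCoincidencePerm x β) : α = β := by
  ext1 i
  by_cases h : ∃ j, j ≠ i ∧ x j = x i
  · obtain ⟨j, hj, hx⟩ := h
    rw [(hα i).1 j hj hx, (hβ i).1 j hj hx]
  · rw [(hα i).2 h, (hβ i).2 h]

end IsCoincidencePerm

-- The hypothesis says that each value is taken at most twice, so exchanging the two occurrences is
-- a well-defined involution.
open Classical in
theorem exists_isCoincidencePerm {l : ℕ} {x : Fin (l + 1) → V}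
    (hx : ∀ i j m, j ≠ i → m ≠ i → x j = x i → x m = x i → j = m) :
    ∃ α, IsCoincidencePerm x α := by
  let g (i : Fin (l + 1)) : Fin (l + 1) :=
    if h : ∃ j, j ≠ i ∧ x j = x i then h.choose else i
  have hg₁ (i j) (hj : j ≠ i) (hxj : x j = x i) : g i = j := by
    have h : ∃ j, j ≠ i ∧ x j = x i := ⟨j, hj, hxj⟩
    simp only [g, dif_pos h]
    exact hx i _ _ h.choose_spec.1 hj h.choose_spec.2 hxj
  have hg₂ (i) (h : ¬ ∃ j, j ≠ i ∧ x j = x i) : g i = i := by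
    simp only [g, dif_neg h]
  have hg : Function.Involutive g := by
    intro i
    by_cases h : ∃ j, j ≠ i ∧ x j = x i
    · obtain ⟨j, hj, hxj⟩ := h
      rw [hg₁ i j hj hxj, hg₁ j i hj.symm hxj.symm]
    · rw [hg₂ i h, hg₂ i h]
  exact ⟨hg.toPerm, fun i => ⟨hg₁ i, hg₂ i⟩⟩

end CoincidencePerm

/-! ### Relations along the maximal path and orbits of permutations. -/

section MaximalWalk

open PathAlgebra

variable {k : Type w} [Field k] {V : Type u} [Quiver.{v} V] [Fintype V]
  {I : TwoSidedIdeal (PathAlgebra k V)}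

/-- The arrows `f i` and the vertices `x i` are successively visited by a path which is maximal
among the paths that are nonzero modulo `I`, and which passes through all arrows. -/
structure IsMaximalWalk (I : TwoSidedIdeal (PathAlgebra k V)) {l : ℕ} (x : Fin (l + 1) → V)
    (f : Fin l → QArrow V) : Prop where
  source : ∀ i, (f i).1 = x i.castSucc
  target : ∀ i, (f i).2.1 = x i.succ
  nonzeroProd : ∀ i j, i.succ = j.castSucc → NonzeroProd I (f i) (f j)
  first : ∀ i e, i.castSucc = 0 → ¬ NonzeroProd I e (f i)
  last : ∀ i e, i.succ = Fin.last l → ¬ NonzeroProd I (f i) e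
  surjective : Function.Surjective f

namespace IsMaximalWalk

variable {l : ℕ} {x : Fin (l + 1) → V} {f : Fin l → QArrow V}

/-- If an arrow occurred twice, its unique predecessors with nonzero product would agree as well.
Going back, the first arrow would have a predecessor. -/
theorem injective (h : IsMaximalWalk I x f) (hI : IsLocallyGentle I) : Function.Injective f := by
  have key (n : ℕ) : ∀ i j : Fin l, (i : ℕ) = n → f i = f j → i = j := by
    induction n with
    | zero =>
      intro i j hi hij
      by_contra hne
      have hj : (j : ℕ) ≠ 0 := fun hj => hne (Fin.ext (hi.trans hj.symm))
      refine h.first i (f ⟨j - 1, by omega⟩) (Fin.ext hi) ?_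
      rw [hij]
      exact h.nonzeroProd _ _ (Fin.ext (by simp; omega))
    | succ n ih =>
      intro i j hi hij
      have hpred : NonzeroProd I (f ⟨n, by omega⟩) (f i) :=
        h.nonzeroProd _ _ (Fin.ext (by simp; omega))
      by_cases hj : (j : ℕ) = 0
      · exact absurd (hij ▸ hpred) (h.first j _ (Fin.ext hj))
      · have hpred' : NonzeroProd I (f ⟨j - 1, by omega⟩) (f j) :=
          h.nonzeroProd _ _ (Fin.ext (by simp; omega))
        rw [← hij] at hpred'
        have := ih _ _ rfl (hpred.left_unique hI hpred')
        simp only [Fin.mk.injEq] at this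
        exact Fin.ext (by omega)
  exact fun i j hij => key i i j rfl hij

/-- The only arrow with nonzero product after `f i` is the next one on the walk, and there is none
after the last; every other composable arrow gives a relation. -/
theorem isRelation_iff (h : IsMaximalWalk I x f) (hI : IsLocallyGentle I) (i j : Fin l) :
    IsRelation I (f i) (f j) ↔ j.castSucc ≠ i.succ ∧ x j.castSucc = x i.succ := by
  constructor
  · intro hij
    refine ⟨fun hne => h.nonzeroProd i j hne.symm hij.2, ?_⟩
    rw [← h.source, ← h.target, hij.1]
  · rintro ⟨hne, hx⟩
    refine ⟨(h.target i).trans (hx.symm.trans (h.source j).symm), ?_⟩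
    by_contra hij
    have hij : NonzeroProd I (f i) (f j) := hij
    by_cases hi : i.succ = Fin.last l
    · exact h.last i _ hi hij
    · obtain ⟨m, hm⟩ := Fin.exists_castSucc_eq.2 hi
      have := h.injective hI (hij.right_unique hI (h.nonzeroProd i m hm.symm))
      exact hne (this ▸ hm)

/-- The arrow arriving at the last of three visits would form relations with the arrows leaving at
both earlier visits, and these are distinct. -/
theorem not_three (h : IsMaximalWalk I x f) (hI : IsLocallyGentle I) {i j m : Fin (l + 1)}
    (hij : i < j) (hjm : j < m) (hi : x i = x m) (hj : x j = x m) : False := by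
  obtain ⟨i, rfl⟩ := Fin.exists_castSucc_eq.2 (hij.trans_le (Fin.le_last j)).ne
  obtain ⟨j, rfl⟩ := Fin.exists_castSucc_eq.2 (hjm.trans_le (Fin.le_last m)).ne
  obtain ⟨m, rfl⟩ := Fin.exists_succ_eq.2 ((Fin.zero_le _).trans_lt hjm).ne'
  have h₁ := (h.isRelation_iff hI m i).2 ⟨(hij.trans hjm).ne, hi⟩
  have h₂ := (h.isRelation_iff hI m j).2 ⟨hjm.ne, hj⟩
  have := h.injective hI (h₁.right_unique hI h₂)
  exact hij.ne (congrArg _ this)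

theorem eq_of_vertex_eq (h : IsMaximalWalk I x f) (hI : IsLocallyGentle I) {i j m : Fin (l + 1)}
    (hj : j ≠ i) (hm : m ≠ i) (hxj : x j = x i) (hxm : x m = x i) : j = m := by
  by_contra hjm
  rcases lt_or_gt_of_ne hj with hj | hj <;> rcases lt_or_gt_of_ne hm with hm | hm <;>
    rcases lt_or_gt_of_ne hjm with hjm | hjm
  · exact h.not_three hI hjm hm hxj hxm
  · exact h.not_three hI hjm hj hxm hxj
  · exact h.not_three hI hj hm (hxj.trans hxm.symm) hxm.symm
  · exact (hj.trans hm).not_gt hjm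
  · exact (hm.trans hj).not_gt hjm
  · exact h.not_three hI hm hj (hxm.trans hxj.symm) hxj.symm
  · exact h.not_three hI hj hjm hxm.symm (hxj.trans hxm.symm)
  · exact h.not_three hI hm hjm hxj.symm (hxm.trans hxj.symm)

end IsMaximalWalk

theorem forall_permOrbits_iff {n : ℕ} (σ : Equiv.Perm (Fin n)) (P : Fin n → Prop) :
    (∀ ω ∈ permOrbits σ, ∃ j ∈ ω, P j) ↔ ∀ i, ∃ j, σ.SameCycle i j ∧ P j := by
  have key (i j) : j ∈ MulAction.orbit (Subgroup.zpowers σ) i ↔ σ.SameCycle i j := by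
    constructor
    · rintro ⟨⟨_, m, rfl⟩, rfl⟩
      exact ⟨m, rfl⟩
    · rintro ⟨m, rfl⟩
      exact ⟨⟨_, m, rfl⟩, rfl⟩
  simp only [permOrbits, Set.forall_mem_range, key]

theorem finRotate_castSucc {l : ℕ} (i : Fin l) : finRotate (l + 1) i.castSucc = i.succ := by
  rw [finRotate_apply, Fin.coeSucc_eq_succ]

namespace IsMaximalWalk

variable {l : ℕ} {x : Fin (l + 1) → V} {f : Fin l → QArrow V} {α : Equiv.Perm (Fin (l + 1))}

/-- The arrow `f i` is labelled by its target position `i.succ`. From there `α` moves to the other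
visit of the vertex, and the rotation moves to the target position of the arrow leaving it. -/
theorem isRelation_iff_perm (h : IsMaximalWalk I x f) (hI : IsLocallyGentle I)
    (hα : IsCoincidencePerm x α) (i j : Fin l) :
    IsRelation I (f i) (f j) ↔
      α i.succ ≠ i.succ ∧ (finRotate (l + 1) * α) i.succ = j.succ := by
  rw [h.isRelation_iff hI, Equiv.Perm.mul_apply, ← finRotate_castSucc j,
    (finRotate (l + 1)).injective.eq_iff]
  constructor
  · rintro ⟨hne, hx⟩
    have := (hα i.succ).1 _ hne hx
    exact ⟨this ▸ hne, this⟩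
  · rintro ⟨hne, hα'⟩
    rw [← hα']
    exact ⟨hne, hα.vertex_eq _⟩

theorem acyclic_iff (h : IsMaximalWalk I x f) (hI : IsLocallyGentle I)
    (hα : IsCoincidencePerm x α) :
    (∀ a, ¬ Relation.TransGen (IsRelation I) a a) ↔
      ∀ i, ∃ j, (finRotate (l + 1) * α).SameCycle i j ∧ (j = 0 ∨ α j = j) := by
  set σ := finRotate (l + 1) * α with hσ
  constructor
  · intro hac
    -- On an orbit avoiding `0` and the fixed points, every position labels an arrow and every step
    -- of `σ` is a relation.
    by_contra! hcon
    obtain ⟨i₀, hi₀⟩ := hcon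
    obtain ⟨i, rfl⟩ := Fin.exists_succ_eq.2 (hi₀ i₀ (Equiv.Perm.SameCycle.refl _ _)).1
    have key (n : ℕ) : ∃ j : Fin l, (σ ^ (n + 1)) i.succ = j.succ ∧
        Relation.TransGen (IsRelation I) (f i) (f j) := by
      induction n with
      | zero =>
        obtain ⟨j, hj⟩ := Fin.exists_succ_eq.2 (hi₀ (σ i.succ) ⟨1, by simp⟩).1
        exact ⟨j, by simp [hj], .single ((h.isRelation_iff_perm hI hα i j).2
          ⟨(hi₀ _ (Equiv.Perm.SameCycle.refl _ _)).2, hj.symm⟩)⟩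
      | succ n ih =>
        obtain ⟨m, hm, hm'⟩ := ih
        have hm₂ : (σ ^ (n + 1 + 1)) i.succ = σ m.succ := by
          rw [pow_succ', Equiv.Perm.mul_apply, hm]
        obtain ⟨j, hj⟩ := Fin.exists_succ_eq.2
          (hi₀ (σ m.succ) ⟨(n + 1 + 1 : ℕ), by rw [zpow_natCast, hm₂]⟩).1
        exact ⟨j, hm₂.trans hj.symm, hm'.tail ((h.isRelation_iff_perm hI hα m j).2
          ⟨(hi₀ _ ⟨(n + 1 : ℕ), by rw [zpow_natCast, hm]⟩).2, hj.symm⟩)⟩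
    -- `key n` concerns the power `n + 1`, so this is the return to the start after `orderOf σ`
    -- steps.
    obtain ⟨j, hj, hj'⟩ := key (orderOf σ - 1)
    rw [Nat.sub_add_cancel (orderOf_pos σ), pow_orderOf_eq_one, Equiv.Perm.one_apply,
      Fin.succ_inj] at hj
    exact hac _ (hj ▸ hj')
  · intro hcyc a ha
    obtain ⟨i, rfl⟩ := h.surjective a
    have key (n : ℕ) : ∃ j : Fin l, (σ ^ n) i.succ = j.succ ∧ α j.succ ≠ j.succ ∧
        Relation.TransGen (IsRelation I) (f j) (f i) := by
      have step (j : Fin l) (hj : Relation.TransGen (IsRelation I) (f j) (f i)) :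
          ∃ m : Fin l, σ j.succ = m.succ ∧ α j.succ ≠ j.succ ∧
            Relation.TransGen (IsRelation I) (f m) (f i) := by
        obtain ⟨c, hjc, hci⟩ := Relation.TransGen.head'_iff.1 hj
        obtain ⟨m, rfl⟩ := h.surjective c
        obtain ⟨hne, hm⟩ := (h.isRelation_iff_perm hI hα j m).1 hjc
        -- Going once more around the cycle by `ha` keeps the chain nonempty even if `f m` is
        -- already `f i`.
        exact ⟨m, hm, hne, Relation.TransGen.trans_right hci ha⟩
      have hfix (j : Fin l) (hj : Relation.TransGen (IsRelation I) (f j) (f i)) :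
          α j.succ ≠ j.succ := by
        obtain ⟨_, _, hne, _⟩ := step j hj
        exact hne
      induction n with
      | zero => exact ⟨i, by simp, hfix i ha, ha⟩
      | succ n ih =>
        obtain ⟨j, hj, -, hj'⟩ := ih
        obtain ⟨m, hm, -, hm'⟩ := step j hj'
        exact ⟨m, by rw [pow_succ', Equiv.Perm.mul_apply, hj, hm], hfix m hm', hm'⟩
    obtain ⟨j, hij, hj⟩ := hcyc i.succ
    obtain ⟨n, -, hn⟩ := hij.exists_pow_eq'
    obtain ⟨m, hm, hne, -⟩ := key n
    rw [hn] at hm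
    subst hm
    rcases hj with hj | hj
    · exact Fin.succ_ne_zero m hj
    · exact hne hj

end IsMaximalWalk

/-- The involution `α` conjugates `ζα` into `αζ` and preserves its own fixed points. As `ζα` sends
`α (Fin.last l)` to `0`, these two lie in one cycle, so `0` is replaced by `Fin.last l`. -/
theorem sameCycle_mul_comm_iff {l : ℕ} {α : Equiv.Perm (Fin (l + 1))}
    (hα : Function.Involutive α) :
    (∀ i, ∃ j, (finRotate (l + 1) * α).SameCycle i j ∧ (j = 0 ∨ α j = j)) ↔
      ∀ i, ∃ j, (α * finRotate (l + 1)).SameCycle i j ∧ (j = Fin.last l ∨ α j = j) := by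
  have hα' : α⁻¹ = α := by
    ext1 i
    rw [Equiv.Perm.inv_eq_iff_eq, hα]
  have hconj : α * finRotate (l + 1) = α * (finRotate (l + 1) * α) * α⁻¹ := by group
  have key (i j) : (α * finRotate (l + 1)).SameCycle i j ↔
      (finRotate (l + 1) * α).SameCycle (α i) (α j) := by
    rw [hconj, Equiv.Perm.sameCycle_conj, hα']
  have hlast (i) : (finRotate (l + 1) * α).SameCycle i 0 ↔
      (finRotate (l + 1) * α).SameCycle i (α (Fin.last l)) := by
    rw [← Equiv.Perm.sameCycle_apply_right (y := α (Fin.last l)), Equiv.Perm.mul_apply, hα,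
      finRotate_last]
  constructor
  · intro h i
    obtain ⟨j, hj, rfl | hj'⟩ := h (α i)
    · exact ⟨Fin.last l, (key _ _).2 ((hlast _).1 hj), .inl rfl⟩
    · exact ⟨j, (key _ _).2 (by rwa [hj']), .inr hj'⟩
  · intro h i
    obtain ⟨j, hj, rfl | hj'⟩ := h (α i)
    · exact ⟨0, (hlast _).2 (by have := (key _ _).1 hj; rwa [hα] at this), .inl rfl⟩
    · exact ⟨j, by have := (key _ _).1 hj; rwa [hα, hj'] at this, .inr hj'⟩

end MaximalWalk

/-! ### The unique maximal path as a maximal walk. -/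

section MaximalPath

open PathAlgebra

variable {V : Type u} [Quiver.{v} V]

theorem source_getElem_pathArrows {a b : V} (p : Quiver.Path a b) (i : ℕ)
    (hi : i < (pathArrows p).length) (hi' : i < p.vertices.length) :
    (pathArrows p)[i].1 = p.vertices[i] := by
  induction p with
  | nil => simp at hi
  | @cons b c p e ih =>
    simp only [pathArrows_cons, Quiver.Path.vertices_cons, List.concat_eq_append,
      List.getElem_append, length_pathArrows, Quiver.Path.vertices_length]
    simp only [length_pathArrows, Quiver.Path.length_cons] at hi
    by_cases h : i < p.length
    · rw [dif_pos h, dif_pos (by omega)]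
      exact ih _ _
    · obtain rfl : i = p.length := by omega
      have := p.vertices_getLast
      rw [List.getLast_eq_getElem] at this
      simp only [Quiver.Path.vertices_length, Nat.add_sub_cancel] at this
      simp [this]

theorem target_getElem_pathArrows {a b : V} (p : Quiver.Path a b) (i : ℕ)
    (hi : i < (pathArrows p).length) (hi' : i + 1 < p.vertices.length) :
    (pathArrows p)[i].2.1 = p.vertices[i + 1] := by
  induction p with
  | nil => simp at hi
  | @cons b c p e ih =>
    have hi₂ : i < p.length + 1 := by simpa using hi
    by_cases h : i < p.length
    · have h₁ : i < (pathArrows p).length := by rwa [length_pathArrows]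
      have h₂ : i + 1 < p.vertices.length := by rw [Quiver.Path.vertices_length]; omega
      have key : (pathArrows (p.cons e))[i] = (pathArrows p)[i] := by
        simp [h]
      refine (congrArg (fun e : QArrow V => e.2.1) key).trans ((ih h₁ h₂).trans ?_)
      simp [h]
    · obtain rfl : i = p.length := by omega
      have key : (pathArrows (p.cons e))[p.length] = ⟨b, c, e⟩ := by
        simp
      refine (congrArg (fun e : QArrow V => e.2.1) key).trans ?_
      simp

/-- The `i`-th arrow of a path. -/
def pathArrow {a b : V} (p : Quiver.Path a b) (i : Fin p.length) : QArrow V :=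
  (pathArrows p)[i]'(by rw [length_pathArrows]; exact i.2)

variable {k : Type w} [Field k] [Fintype V] {I : TwoSidedIdeal (PathAlgebra k V)}

/-- Only finitely many paths are nonzero, so there is a longest one through `e`; it cannot be
extended. -/
theorem exists_maximalPath_mem_arrows (hI : IsGentle I) (e : QArrow V) :
    ∃ q : QPath V, IsMaximalPath I q ∧ e ∈ pathArrows q.2.2 := by
  let S : Set (QPath V) := {q | ofPath k q.2.2 ∉ I ∧ e ∈ pathArrows q.2.2}
  have hS : S.Finite := (finite_nonzero_paths hI).subset fun q hq => hq.1
  have hne : S.Nonempty := ⟨⟨e.1, e.2.1, e.2.2.toPath⟩, by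
    rw [ofPath_mem_iff hI.toIsLocallyGentle]
    simp, by simp⟩
  obtain ⟨⟨a, b, q⟩, ⟨hq, he⟩, hmax⟩ := Set.exists_max_image S (fun q => q.2.2.length) hS hne
  refine ⟨⟨a, b, q⟩, ⟨hq, fun c d f => ⟨?_, ?_⟩⟩, he⟩
  · by_cases hbc : b = c
    · subst hbc
      by_contra hf
      rw [ofPath_mul_ofArrow] at hf
      have := hmax ⟨a, d, q.cons f⟩ ⟨hf, by simp only [pathArrows_cons]; exact List.mem_append_left _ he⟩
      simp at this
    · rw [ofArrow, ofPath_mul_of_ne _ _ hbc]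
      exact I.zero_mem
  · by_cases hda : d = a
    · subst hda
      by_contra hf
      rw [ofArrow, ofPath_mul_comp] at hf
      have := hmax ⟨c, b, f.toPath.comp q⟩
        ⟨hf, by simp only [pathArrows_comp]; exact List.mem_append_right _ he⟩
      simp at this
    · rw [ofArrow, ofPath_mul_of_ne _ _ hda]
      exact I.zero_mem

/-- Maximality only says that `p` extended by an arrow lies in `I`. As `I` is monomial and the
arrows of `p` form a chain, the vanishing must occur at the new joint. Surjectivity holds since the
maximal path through any arrow is `p`. -/
theorem isMaximalWalk (hI : IsGentle I) {a b : V} (p : Quiver.Path a b)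
    (hp : IsMaximalPath I ⟨a, b, p⟩) (hunique : ∀ q : QPath V, IsMaximalPath I q → q = ⟨a, b, p⟩) :
    IsMaximalWalk I (pathVertex p) (pathArrow p) where
  source i := source_getElem_pathArrows p i _ _
  target i := target_getElem_pathArrows p i _ _
  nonzeroProd i j hij := by
    have hchain : (pathArrows p).IsChain (NonzeroProd I) :=
      not_not.1 fun h => hp.1 (ofPath_mem_of_not_isChain p h)
    rw [List.isChain_iff_getElem] at hchain
    obtain ⟨j, hj⟩ := j
    obtain rfl : (i : ℕ) + 1 = j := congrArg Fin.val hij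
    exact hchain i (by rw [length_pathArrows]; exact hj)
  first i e hi he := by
    have hchain : (pathArrows p).IsChain (NonzeroProd I) :=
      not_not.1 fun h => hp.1 (ofPath_mem_of_not_isChain p h)
    have hi : (i : ℕ) = 0 := congrArg Fin.val hi
    have hsource : (pathArrow p i).1 = a := by
      rw [pathArrow, Fin.getElem_fin, source_getElem_pathArrows _ _ _ (by simp)]
      simp only [hi]
      exact p.getElem_vertices_zero
    have ht := he.target_eq.trans hsource
    obtain ⟨s, t, e⟩ := e
    obtain rfl : t = a := ht
    have := (hp.2 s t e).2
    rw [ofArrow, ofPath_mul_comp, ofPath_mem_iff hI.toIsLocallyGentle] at this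
    apply this
    rw [pathArrows_comp, pathArrows_toPath, List.isChain_append]
    refine ⟨List.isChain_singleton _, hchain, fun x hx y hy => ?_⟩
    obtain rfl : (⟨s, t, e⟩ : QArrow V) = x := by simpa using hx
    have hy' : (pathArrows p)[0]? = some y := by rwa [← List.head?_eq_getElem?]
    obtain ⟨_, rfl⟩ := List.getElem?_eq_some_iff.1 hy'
    simpa only [pathArrow, Fin.getElem_fin, hi] using he
  last i e hi he := by
    have hchain : (pathArrows p).IsChain (NonzeroProd I) :=
      not_not.1 fun h => hp.1 (ofPath_mem_of_not_isChain p h)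
    have hi : (i : ℕ) + 1 = p.length := congrArg Fin.val hi
    have htarget : (pathArrow p i).2.1 = b := by
      rw [pathArrow, Fin.getElem_fin, target_getElem_pathArrows _ _ _ (by simp)]
      have := p.vertices_getLast
      rw [List.getLast_eq_getElem] at this
      simpa only [Quiver.Path.vertices_length, Nat.add_sub_cancel, hi] using this
    have ht := he.target_eq.symm.trans htarget
    obtain ⟨s, t, e⟩ := e
    obtain rfl : s = b := ht
    have := (hp.2 s t e).1
    rw [ofPath_mul_ofArrow, ofPath_mem_iff hI.toIsLocallyGentle] at this
    apply this
    rw [pathArrows_cons, List.isChain_append]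
    refine ⟨hchain, List.isChain_singleton _, fun x hx y hy => ?_⟩
    obtain rfl : (⟨s, t, e⟩ : QArrow V) = y := by simpa using hy
    have hx' : (pathArrows p)[(i : ℕ)]? = some x := by
      rw [Option.mem_def, List.getLast?_eq_getElem?, length_pathArrows, ← hi,
        Nat.add_sub_cancel] at hx
      exact hx
    obtain ⟨_, rfl⟩ := List.getElem?_eq_some_iff.1 hx'
    exact he
  surjective e := by
    obtain ⟨q, hq, he⟩ := exists_maximalPath_mem_arrows hI e
    rw [hunique q hq] at he
    obtain ⟨i, hi, rfl⟩ := List.mem_iff_getElem.1 he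
    exact ⟨⟨i, by rwa [length_pathArrows] at hi⟩, rfl⟩

end MaximalPath

theorem theorem3p2 {k : Type w} [Field k] [IsAlgClosed k] [CharZero k]
    {V : Type u} [Quiver.{v} V] [Fintype V]
    (I : TwoSidedIdeal (PathAlgebra k V)) (hI : IsGentle I)
    {A : Type*} [Ring A] [Algebra k A] (φ : A ≃ₐ[k] QuiverAlgebra I)
    {a b : V} (p : Quiver.Path a b) (hp : IsMaximalPath I ⟨a, b, p⟩)
    (hunique : ∀ q : QPath V, IsMaximalPath I q → q = ⟨a, b, p⟩) :
    (∃! α : Equiv.Perm (Fin (p.length + 1)), IsAssociatedPerm p α) ∧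
    ∀ α : Equiv.Perm (Fin (p.length + 1)), IsAssociatedPerm p α →
      Function.Involutive α ∧
      List.TFAE [
        globalDimension A < ⊤,
        ∀ ω ∈ permOrbits (finRotate (p.length + 1) * α), 0 ∈ ω ∨ ∃ i ∈ ω, α i = i,
        ∀ ω ∈ permOrbits (α * finRotate (p.length + 1)),
          Fin.last p.length ∈ ω ∨ ∃ i ∈ ω, α i = i] := by
  have hI' := hI.toIsLocallyGentle
  have hwalk := isMaximalWalk hI p hp hunique
  constructor
  · obtain ⟨α, hα⟩ := exists_isCoincidencePerm fun i j m => hwalk.eq_of_vertex_eq hI'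
    exact ⟨α, hα, fun β hβ => IsCoincidencePerm.unique hβ hα⟩
  · intro α hα
    -- The two notions agree by definition.
    have hα : IsCoincidencePerm (pathVertex p) α := hα
    refine ⟨hα.involutive, ?_⟩
    have key (ω : Set (Fin (p.length + 1))) (c) :
        (c ∈ ω ∨ ∃ i ∈ ω, α i = i) ↔ ∃ i ∈ ω, i = c ∨ α i = i := by
      constructor
      · rintro (h | ⟨i, hi, h⟩)
        exacts [⟨c, h, .inl rfl⟩, ⟨i, hi, .inr h⟩]
      · rintro ⟨i, hi, rfl | h⟩
        exacts [.inl hi, .inr ⟨i, hi, h⟩]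
    simp only [key, forall_permOrbits_iff]
    tfae_have 1 ↔ 2 := (globalDimension_lt_top_iff hI φ).trans (hwalk.acyclic_iff hI' hα)
    tfae_have 2 ↔ 3 := sameCycle_mul_comm_iff hα.involutive
    tfae_finish
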